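/- Let $(W,S)$ be a Coxeter system with length function $\ell$. Let $\widehat S$ be a set partition of $S$ each of whose blocks $I$ generates a finite parabolic subgroup $W_I$; let $r_I$ be the element of maximal length of $W_I$ and let $\widehat W\le W$ be the subgroup generated by $R=\{r_I : I\in\widehat S\}$. The partition is \emph{admissible} if for all $w\in\widehat W$ and $I\in\widehat S$ either $\ell(ws)=\ell(w)+1$ for every $s\in I$ or $\ell(ws)=\ell(w)-1$ for every $s\in I$; then $\widehat W$ is called a \emph{folding subgroup} of $W$, and its \emph{unfolding series} is the formal power series $U_{\widehat W}^{W}(q)=\sum_{w\in\widehat W}q^{\ell(w)}$. Write $[k]_x=1+x+\dots+x^{k-1}$. For $m\ge 4$ let $\widetilde D_m$ be the Coxeter group with generators $s_0,\dots,s_m$ whose Coxeter graph is the path $s_1 - s_2 - \cdots - s_{m-1}$ together with the edges $s_0 - s_2$ and $s_{m-2} - s_m$ (all labels $3$). For $n\ge 3$ let $\widetilde B_n$ be the Coxeter group with generators $r_0,\dots,r_n$ whose Coxeter graph is the path $r_0 - r_1 - \cdots - r_{n-1}$ together with the edge $r_{n-2} - r_n$, where the edge $r_0 - r_1$ has label $4$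 and all other edges have label $3$. \textbf{Theorem.} Let $n\ge 3$. In each of the following three cases the indicated elements $r_0,\dots,r_n$ are the longest elements of the parabolic subgroups of the blocks of an admissible partition (the block of $r_i$ is the set of generators $s_j$ that occur in the given word), and the corresponding folding subgroup, with the simple generators $r_0,\dots,r_n$, is a Coxeter system of type $\widetilde B_n$: \begin{enumerate} \item in $\widetilde D_{n+1}$: $r_0=s_0s_1$ and $r_i=s_{i+1}$ for $1\le i\le n$; \item in $\widetilde D_{2n}$: $r_0=s_n$ and $r_i=s_{n-i}s_{n+i}$ for $1\le i\le n$; \item in $\widetilde D_{2n+1}$: $r_0=s_ns_{n+1}s_n$ and $r_i=s_{n-i}s_{n+1+i}$ for $1\le i\le n$. \end{enumerate} The unfolding series are, respectively, \begin{enumerate} \item $\displaystyle U_{\widetilde B_n}^{\widetilde D_{n+1}}(q)=\frac{[2]_q[3]_{-q}[4]_q}{(1-q)(1-q^3)(1+q^n)}\cdot\prod_{k=3}^n\frac{[2k+1]_q-q^k}{1-q^{2k-1}}$; \item $\displaystyle U_{\widetilde B_n}^{\widetilde D_{2n}}(q)=\left(\prod_{k=1}^{2n}[k]_{(-1)^kq}\right)\cdot\left(\prod_{k=2}^{n}\bigl(1+q^{2(k-1)}\bigr)\right)\cdot\left(\prod_{k=1}^{n}\frac{1}{1-q^{2(n+k)-3}}\right)$;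 \item $\displaystyle U_{\widetilde B_n}^{\widetilde D_{2n+1}}(q)=\left(\prod_{k=1}^{2n+1}[k]_{(-1)^kq}\right)\cdot\left(\prod_{k=2}^{n}\bigl(1+q^{2(k-1)}\bigr)\right)\cdot\left(\prod_{k=1}^{n}\frac{1}{1-q^{2(n+k)-1}}\right)$. \end{enumerate} -/

import Mathlib

open PowerSeries

noncomputable section

namespace Folding

/-! ### Affine Coxeter matrices -/

/-- Oriented edges of the Coxeter graph of affine type `D̃_m` (`m ≥ 4`) on the vertices `0, …, m`:
the path `1 - 2 - ⋯ - (m-1)` with two further edges `0 - 2` and `(m-2) - m`. -/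
abbrev EdgeD (m i j : ℕ) : Prop :=
  (i = 0 ∧ j = 2) ∨ (1 ≤ i ∧ j = i + 1 ∧ j + 1 ≤ m) ∨ (i + 2 = m ∧ j = m)

/-- The Coxeter matrix of affine type `D̃_m` (for `m ≥ 4`), generators `s_0, …, s_m`. -/
def affineD (m : ℕ) : CoxeterMatrix (Fin (m + 1)) where
  M := Matrix.of fun i j =>
    if i = j then 1 else if EdgeD m i j ∨ EdgeD m j i then 3 else 2
  isSymm := by
    ext i j
    simp only [Matrix.transpose_apply, Matrix.of_apply, eq_comm (a := j) (b := i),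
      or_comm (a := EdgeD m j i)]
  diagonal := by simp
  off_diagonal := by
    intro i j h
    simp only [Matrix.of_apply, if_neg h]
    split_ifs <;> decide

/-- Oriented simple edges of the Coxeter graph of affine type `B̃_n` (`n ≥ 3`) on the vertices
`0, …, n`: the path `1 - 2 - ⋯ - (n-1)` with one further edge `(n-2) - n`. -/
abbrev EdgeB (n i j : ℕ) : Prop :=
  (1 ≤ i ∧ j = i + 1 ∧ j + 1 ≤ n) ∨ (i + 2 = n ∧ j = n)

/-- The Coxeter matrix of affine type `B̃_n` (for `n ≥ 3`), generators `r_0, …, r_n`;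
the edge `0 - 1` carries the label `4`. -/
def affineB (n : ℕ) : CoxeterMatrix (Fin (n + 1)) where
  M := Matrix.of fun i j =>
    if i = j then 1
    else if ((i : ℕ) = 0 ∧ (j : ℕ) = 1) ∨ ((j : ℕ) = 0 ∧ (i : ℕ) = 1) then 4
    else if EdgeB n i j ∨ EdgeB n j i then 3 else 2
  isSymm := by
    ext i j
    simp only [Matrix.transpose_apply, Matrix.of_apply, eq_comm (a := j) (b := i),
      or_comm (a := EdgeB n j i), or_comm (a := (j : ℕ) = 0 ∧ (i : ℕ) = 1)]
  diagonal := by simp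
  off_diagonal := by
    intro i j h
    simp only [Matrix.of_apply, if_neg h]
    split_ifs <;> decide

/-! ### Foldings -/

section General

variable {B ι W : Type*} [Group W] {M : CoxeterMatrix B}

/-- The parabolic subgroup `W_I` generated by the simple reflections indexed by `I`. -/
def parabolic (cs : CoxeterSystem M W) (I : Set B) : Subgroup W :=
  Subgroup.closure (cs.simple '' I)

/-- `x` is the element of maximal length of the subgroup `H`. -/
def IsLongestElement (cs : CoxeterSystem M W) (H : Subgroup W) (x : W) : Prop :=
  x ∈ H ∧ ∀ w ∈ H, w ≠ x → cs.length w < cs.length x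

/-- The subgroup of `W` generated by the elements `r i`. -/
def foldingSubgroup (r : ι → W) : Subgroup W :=
  Subgroup.closure (Set.range r)

/-- A set partition of the simple generators is given by a surjection `p` onto the set `ι` of its
blocks, the block of `i` being the fibre `p ⁻¹' {i}`. `IsAdmissible cs p r` says that each block
generates a finite parabolic subgroup, that `r i` is the longest element of the parabolic subgroup
of the block `i`, and that the partition is admissible: for each `w` in the subgroup generated by
the `r i`, each block consists only of right ascents or only of right descents of `w`. -/
structure IsAdmissible (cs : CoxeterSystem M W) (p : B → ι) (r : ι → W) : Prop where
  surjective : Function.Surjective p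
  finite_parabolic : ∀ i, (parabolic cs (p ⁻¹' {i}) : Set W).Finite
  longest : ∀ i, IsLongestElement cs (parabolic cs (p ⁻¹' {i})) (r i)
  ascents_or_descents : ∀ w ∈ foldingSubgroup r, ∀ i,
    (∀ b, p b = i → cs.length (w * cs.simple b) = cs.length w + 1) ∨
    (∀ b, p b = i → cs.length (w * cs.simple b) + 1 = cs.length w)

/-- The subgroup generated by the elements `r i`, with the `r i` as simple generators, is a Coxeter
system with Coxeter matrix `N`. -/
def IsCoxeterOfType (N : CoxeterMatrix ι) (r : ι → W) : Prop :=
  ∃ c : CoxeterSystem N (foldingSubgroup r), ∀ i, (c.simple i : W) = r i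

/-- The unfolding series `∑_{w ∈ H} q ^ ℓ(w)` of a subgroup `H` of `W`, where `ℓ` is the length
in `W`: the coefficient of `q ^ k` is the number of `w ∈ H` with `ℓ(w) = k`. -/
def unfoldingSeries (cs : CoxeterSystem M W) (H : Subgroup W) : ℚ⟦X⟧ :=
  PowerSeries.mk fun k => ({w : W | w ∈ H ∧ cs.length w = k}.ncard : ℚ)

/-- The sets counted by `unfoldingSeries` are finite when there are finitely many generators. -/
theorem finite_length_eq [Finite B] (cs : CoxeterSystem M W) (H : Subgroup W) (k : ℕ) :
    {w : W | w ∈ H ∧ cs.length w = k}.Finite := by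
  refine ((List.finite_length_eq B k).image cs.wordProd).subset ?_
  rintro w ⟨-, hw⟩
  obtain ⟨ω, h, rfl⟩ := cs.exists_isReduced w
  exact ⟨ω, h.eq.symm.trans hw, rfl⟩

end General

/-! ### The three foldings of `B̃_n` in affine type `D` -/

section Tables

variable {W : Type*} [Group W]

/-- Partition of the generators of `D̃_{n+1}`: the only block with two elements is `{s_0, s_1}`
(block `0`); the block `i ≠ 0` is `{s_{i+1}}`. -/
def part₁ (n : ℕ) (b : Fin (n + 1 + 1)) : Fin (n + 1) :=
  ⟨(b : ℕ) - 1, by omega⟩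

/-- `r_0 = s_0 s_1` and `r_i = s_{i+1}` for `i ≠ 0`, in `D̃_{n+1}`. -/
def refl₁ (n : ℕ) (cs : CoxeterSystem (affineD (n + 1)) W) (i : Fin (n + 1)) : W :=
  if (i : ℕ) = 0 then cs.simple ⟨0, by omega⟩ * cs.simple ⟨1, by omega⟩
  else cs.simple ⟨(i : ℕ) + 1, by omega⟩

/-- Partition of the generators of `D̃_{2n}`: the block `i` is `{s_{n-i}, s_{n+i}}`. The expression
is the distance of `b` and `n`, as the subtractions are truncated. -/
def part₂ (n : ℕ) (b : Fin (2 * n + 1)) : Fin (n + 1) :=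
  ⟨((b : ℕ) - n) + (n - (b : ℕ)), by omega⟩

/-- `r_0 = s_n` and `r_i = s_{n-i} s_{n+i}` for `i ≠ 0`, in `D̃_{2n}`. -/
def refl₂ (n : ℕ) (cs : CoxeterSystem (affineD (2 * n)) W) (i : Fin (n + 1)) : W :=
  if (i : ℕ) = 0 then cs.simple ⟨n, by omega⟩
  else cs.simple ⟨n - (i : ℕ), by omega⟩ * cs.simple ⟨n + (i : ℕ), by omega⟩

/-- Partition of the generators of `D̃_{2n+1}`: the block `i` is `{s_{n-i}, s_{n+1+i}}`
(with truncated subtractions, one of the two summands always vanishes). -/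
def part₃ (n : ℕ) (b : Fin (2 * n + 1 + 1)) : Fin (n + 1) :=
  ⟨((b : ℕ) - (n + 1)) + (n - (b : ℕ)), by omega⟩

/-- `r_0 = s_n s_{n+1} s_n` and `r_i = s_{n-i} s_{n+1+i}` for `i ≠ 0`, in `D̃_{2n+1}`. -/
def refl₃ (n : ℕ) (cs : CoxeterSystem (affineD (2 * n + 1)) W) (i : Fin (n + 1)) : W :=
  if (i : ℕ) = 0 then
    cs.simple ⟨n, by omega⟩ * cs.simple ⟨n + 1, by omega⟩ * cs.simple ⟨n, by omega⟩
  else cs.simple ⟨n - (i : ℕ), by omega⟩ * cs.simple ⟨n + 1 + (i : ℕ), by omega⟩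

end Tables

/-- The `q`-integer `[k]_x = 1 + x + ⋯ + x ^ (k - 1)`. -/
def qInt {R : Type*} [Semiring R] (k : ℕ) (x : R) : R :=
  ∑ i ∈ Finset.range k, x ^ i

end Folding

end

open Folding

namespace Folding

/-! The proof works with the action of a Coxeter group on its root lattice. For an integral Cartan
matrix with bonds in {2, 3, 4}, `IsCartan.ascent_iff` gives the classical criterion: s is a right
ascent of w exactly when w α_s ≥ 0.

Folding. In each case an involution of the diagram of D̃ induces a length-preserving endomorphism
that fixes every r_i and is transitive on each block. Hence elements of the folding subgroup ascend,
or descend, along a whole block at once. Moreover there are positive combinations b_i of the simple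
roots of block i on which the r_i act like the simple reflections of B̃_n. An element of the folding
subgroup that fixes all b_i has no descent, so it is 1; this yields the Coxeter relations. By the
sign criterion, an ascent in the abstract group of type B̃_n becomes an ascent along a whole block,
so the length of D̃ pulls back to a weighted length with weights ℓ(r_i). It dominates the length of
B̃_n, which gives injectivity. All this is packaged in `FoldData`.

Counting. The unfolding series is therefore the weighted Poincaré series U of B̃_n, with weight p on
r_0 and q on the other generators, where (p, q) = (2, 1), (1, 2), (3, 2). It is computed in
`ser_affineB`, with a = X^p and b = X^q. The finite parabolic subgroups of types B_k and D_k have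
product series, each factor being a sum over the orbit of the vectors ± e_i (`IsCartan.ser_orbit`).
To reach U, take the alternating sum over k of the series of the elements that ascend at all
vertices below k and descend at all vertices above k. It telescopes to 1: only the identity has no
descent, and no element has only descents, because the null root is fixed. For m = n - k ≥ 2 the
term is U b^{m(m-1)} divided by the series of B_{n-m} and D_m, the exponent coming from the longest
element of D_m; the terms m = 0, 1 are treated by hand. After clearing denominators, the sum becomes
the q-Chu–Vandermonde identity `sum_qBinom_mul_prod`, which determines U. Elementary identities for
q-integers then give the three closed forms. -/

/-- An integral generalized Cartan matrix `A` for a Coxeter matrix with entries in `{1, 2, 3, 4}`. -/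
structure IsCartan {B : Type*} (M : CoxeterMatrix B) (A : B → B → ℤ) : Prop where
  diag : ∀ i, A i i = 2
  off_diag : ∀ i j, i ≠ j → (M i j = 2 ∧ A i j = 0 ∧ A j i = 0) ∨
    (M i j = 3 ∧ A i j = -1 ∧ A j i = -1) ∨
    (M i j = 4 ∧ (A i j = -1 ∧ A j i = -2 ∨ A i j = -2 ∧ A j i = -1))

/-! ### Root lattice and reflection representation -/

section Pairing

variable {B ι : Type*} [Fintype B] (A : ι → B → ℤ)

/-- The linear functional `v ↦ ∑ j, A i j * v j`. -/
def pairing (i : ι) : (B → ℤ) →ₗ[ℤ] ℤ := ∑ j, A i j • LinearMap.proj j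

theorem pairing_apply (i : ι) (v : B → ℤ) : pairing A i v = ∑ j, A i j * v j := by
  simp [pairing, LinearMap.sum_apply]

@[simp]
theorem pairing_single [DecidableEq B] (i : ι) (j : B) :
    pairing A i (Pi.single j 1) = A i j := by
  simp [pairing_apply, Pi.single_apply]

end Pairing

section Reflection

variable {B : Type*} [Fintype B] [DecidableEq B] (A : B → B → ℤ)

/-- The reflection `v ↦ v - ⟨i, v⟩ α_i` on the root lattice. -/
def rootReflection (i : B) : Module.End ℤ (B → ℤ) :=
  LinearMap.id - (pairing A i).smulRight (Pi.single i 1)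

theorem rootReflection_apply (i : B) (v : B → ℤ) :
    rootReflection A i v = v - pairing A i v • Pi.single i 1 := rfl

theorem rootReflection_single (i j : B) :
    rootReflection A i (Pi.single j 1) = Pi.single j 1 - A i j • Pi.single i 1 := by
  rw [rootReflection_apply, pairing_single]

theorem rootReflection_apply_of_ne {i j : B} (h : j ≠ i) (v : B → ℤ) :
    rootReflection A i v j = v j := by
  simp [rootReflection_apply, h]

variable {A}

/-- The effect of a word in two reflections on v depends on v only through the two pairings with v,
so for bonds 2, 3, 4 each relation unfolds to a linear identity. -/
theorem IsCartan.isLiftable {M : CoxeterMatrix B} (hA : IsCartan M A) :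
    M.IsLiftable (rootReflection A) := by
  intro i j
  by_cases hij : i = j
  · subst hij
    rw [M.diagonal, pow_one]
    refine LinearMap.ext fun v => ?_
    simp only [Module.End.mul_apply, Module.End.one_apply, rootReflection_apply, map_sub, map_smul,
      pairing_single, hA.diag]
    module
  · refine LinearMap.ext fun v => ?_
    rcases hA.off_diag i j hij with ⟨hM, h1, h2⟩ | ⟨hM, h1, h2⟩ | ⟨hM, ⟨h1, h2⟩ | ⟨h1, h2⟩⟩ <;>
    · rw [hM]
      simp only [pow_succ, pow_zero, one_mul, Module.End.mul_apply, Module.End.one_apply,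
        rootReflection_apply, map_sub, map_smul, pairing_single, hA.diag, h1, h2]
      module

end Reflection

section Tits

variable {B W : Type*} [Fintype B] [DecidableEq B] [Group W] {M : CoxeterMatrix B}
  {A : B → B → ℤ} (hA : IsCartan M A) (cs : CoxeterSystem M W)

/-- The action of a Coxeter group on its root lattice. -/
def IsCartan.rep : W →* Module.End ℤ (B → ℤ) := cs.lift ⟨rootReflection A, hA.isLiftable⟩

@[simp]
theorem IsCartan.rep_simple (i : B) : hA.rep cs (cs.simple i) = rootReflection A i :=
  cs.lift_apply_simple _ _

theorem IsCartan.rep_mul_apply (w w' : W) (v : B → ℤ) :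
    hA.rep cs (w * w') v = hA.rep cs w (hA.rep cs w' v) := by
  rw [map_mul, Module.End.mul_apply]

theorem IsCartan.rep_mul_simple (w : W) (i j : B) :
    hA.rep cs (w * cs.simple i) (Pi.single j 1) =
      hA.rep cs w (Pi.single j 1) - A i j • hA.rep cs w (Pi.single i 1) := by
  rw [hA.rep_mul_apply, hA.rep_simple, rootReflection_single, map_sub, map_smul]

theorem IsCartan.rep_mul_simple_self (w : W) (i : B) :
    hA.rep cs (w * cs.simple i) (Pi.single i 1) = -hA.rep cs w (Pi.single i 1) := by
  rw [hA.rep_mul_simple, hA.diag]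
  module

theorem IsCartan.rep_inv_apply_rep (w : W) (v : B → ℤ) :
    hA.rep cs w⁻¹ (hA.rep cs w v) = v := by
  rw [← hA.rep_mul_apply]; simp

theorem IsCartan.rep_apply_rep_inv (w : W) (v : B → ℤ) :
    hA.rep cs w (hA.rep cs w⁻¹ v) = v := by
  rw [← hA.rep_mul_apply]; simp

theorem IsCartan.rep_single_ne_zero (w : W) (i : B) : hA.rep cs w (Pi.single i 1) ≠ 0 := by
  intro h
  have := hA.rep_inv_apply_rep cs w (Pi.single i 1)
  rw [h, map_zero] at this
  have := congrFun this i
  simp at this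

end Tits

/-! ### Ascents and positivity of roots -/

section Braid

variable {B W : Type*} [Group W] {M : CoxeterMatrix B} (cs : CoxeterSystem M W)

theorem simple_comm_of_eq_two {i j : B} (h : M i j = 2) :
    cs.simple i * cs.simple j = cs.simple j * cs.simple i := by
  have := cs.wordProd_braidWord_eq i j
  have h' := (M.symmetric j i).trans h
  simpa [CoxeterSystem.braidWord, CoxeterSystem.alternatingWord, h, h', CoxeterSystem.wordProd]
    using this

theorem simple_braid_of_eq_three {i j : B} (h : M i j = 3) :
    cs.simple i * cs.simple j * cs.simple i = cs.simple j * cs.simple i * cs.simple j := by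
  have := cs.wordProd_braidWord_eq j i
  have h' := (M.symmetric j i).trans h
  simpa [CoxeterSystem.braidWord, CoxeterSystem.alternatingWord, h, h', CoxeterSystem.wordProd,
    mul_assoc] using this

theorem simple_braid_of_eq_four {i j : B} (h : M i j = 4) :
    cs.simple i * cs.simple j * cs.simple i * cs.simple j =
      cs.simple j * cs.simple i * cs.simple j * cs.simple i := by
  have := cs.wordProd_braidWord_eq i j
  have h' := (M.symmetric j i).trans h
  simpa [CoxeterSystem.braidWord, CoxeterSystem.alternatingWord, h, h', CoxeterSystem.wordProd,
    mul_assoc] using this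

theorem length_mul_simple_le (w : W) (i : B) : cs.length (w * cs.simple i) ≤ cs.length w + 1 := by
  rcases cs.length_mul_simple w i with h | h <;> omega

end Braid

section Tits

variable {B W : Type*} [Fintype B] [DecidableEq B] [Group W] {M : CoxeterMatrix B}
  {A : B → B → ℤ} (hA : IsCartan M A) (cs : CoxeterSystem M W)

/-- If `ℓ(w s) > ℓ(w)` then `w α_s` is a positive root. -/
theorem IsCartan.rep_single_nonneg {w : W} {i : B}
    (h : cs.length (w * cs.simple i) = cs.length w + 1) :
    0 ≤ hA.rep cs w (Pi.single i 1) := by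
  induction hl : cs.length w using Nat.strong_induction_on generalizing w i with
  | _ l ih =>
  subst hl
  by_cases hw : w = 1
  · subst hw
    simp
  -- Letters j, i, j are peeled off the end of w until induction applies to the remaining prefix.
  -- The bond of i and j bounds how many can be removed, since otherwise a braid move would
  -- contradict the ascent of w at i.
  obtain ⟨j, hj⟩ := cs.exists_rightDescent_of_ne_one hw
  rw [cs.isRightDescent_iff] at hj
  obtain ⟨v, rfl⟩ : ∃ v, w = v * cs.simple j := ⟨w * cs.simple j, by simp⟩
  rw [cs.simple_mul_simple_cancel_right] at hj
  have hne : i ≠ j := by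
    rintro rfl
    rw [cs.simple_mul_simple_cancel_right] at h
    omega
  have hvj : 0 ≤ hA.rep cs v (Pi.single j 1) := ih _ (by omega) (by omega) rfl
  have haux : 0 ≤ hA.rep cs v (Pi.single i 1) →
      0 ≤ hA.rep cs (v * cs.simple j) (Pi.single i 1) := by
    intro hvi
    rw [hA.rep_mul_simple, sub_nonneg]
    refine le_trans ?_ hvi
    have hji : A j i ≤ 0 := by
      rcases hA.off_diag i j hne with h | h | ⟨-, h | h⟩ <;> omega
    exact smul_nonpos_of_nonpos_of_nonneg hji hvj
  rcases cs.length_mul_simple v i with hvi | hvi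
  · exact haux (ih _ (by omega) hvi rfl)
  obtain ⟨u, rfl⟩ : ∃ u, v = u * cs.simple i := ⟨v * cs.simple i, by simp⟩
  rw [cs.simple_mul_simple_cancel_right] at hvi
  have hui : 0 ≤ hA.rep cs u (Pi.single i 1) := ih _ (by omega) (by omega) rfl
  rcases hA.off_diag i j hne with ⟨hM, h1, h2⟩ | ⟨hM, h1, h2⟩ | ⟨hM, h12⟩
  · exfalso
    have heq : u * cs.simple i * cs.simple j = u * cs.simple j * cs.simple i := by
      rw [mul_assoc, simple_comm_of_eq_two cs hM, ← mul_assoc]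
    rw [heq, cs.simple_mul_simple_cancel_right] at h
    rw [heq] at hj
    have := length_mul_simple_le cs u j
    omega
  -- Bond 3: here w α_i = u s_i s_j α_i = u α_j, so it suffices that u ascends at j.
  · have huj : cs.length (u * cs.simple j) = cs.length u + 1 := by
      refine (cs.length_mul_simple u j).resolve_right fun hc => ?_
      have hb := simple_braid_of_eq_three cs hM
      rw [show u * cs.simple i * cs.simple j * cs.simple i =
        u * (cs.simple i * cs.simple j * cs.simple i) by group, hb, ← mul_assoc, ← mul_assoc] at h
      have := length_mul_simple_le cs (u * cs.simple j * cs.simple i) j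
      have := length_mul_simple_le cs (u * cs.simple j) i
      omega
    have := ih _ (by omega) huj rfl
    rw [hA.rep_mul_simple, hA.rep_mul_simple, hA.rep_mul_simple, h1, h2, hA.diag]
    refine this.trans_eq ?_
    module
  -- Bond 4: if u ascends at j, then w α_i is a positive combination of u α_i and u α_j. Otherwise
  -- one more letter comes off, u = x s_j, and w α_i = x α_i.
  · rcases cs.length_mul_simple u j with huj | huj
    · have huj' := ih _ (by omega) huj rfl
      rw [hA.rep_mul_simple, hA.rep_mul_simple, hA.rep_mul_simple, hA.diag]
      rcases h12 with ⟨h1, h2⟩ | ⟨h1, h2⟩ <;> rw [h1, h2]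
      · refine (add_nonneg hui (add_nonneg huj' huj')).trans_eq ?_
        module
      · refine (add_nonneg hui huj').trans_eq ?_
        module
    · obtain ⟨x, rfl⟩ : ∃ x, u = x * cs.simple j := ⟨u * cs.simple j, by simp⟩
      rw [cs.simple_mul_simple_cancel_right] at huj
      have hxi : cs.length (x * cs.simple i) = cs.length x + 1 := by
        refine (cs.length_mul_simple x i).resolve_right fun hc => ?_
        have hb := simple_braid_of_eq_four cs hM
        rw [show x * cs.simple j * cs.simple i * cs.simple j * cs.simple i =
          x * (cs.simple j * cs.simple i * cs.simple j * cs.simple i) by group, ← hb,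
          ← mul_assoc, ← mul_assoc, ← mul_assoc] at h
        have := length_mul_simple_le cs (x * cs.simple i * cs.simple j * cs.simple i) j
        have := length_mul_simple_le cs (x * cs.simple i * cs.simple j) i
        have := length_mul_simple_le cs (x * cs.simple i) j
        omega
      have := ih _ (by omega) hxi rfl
      simp only [hA.rep_mul_simple, hA.diag]
      rcases h12 with ⟨h1, h2⟩ | ⟨h1, h2⟩ <;> rw [h1, h2]
      · refine this.trans_eq ?_
        module
      · refine this.trans_eq ?_
        module

theorem IsCartan.rep_single_nonpos {w : W} {i : B}
    (h : cs.length (w * cs.simple i) + 1 = cs.length w) :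
    hA.rep cs w (Pi.single i 1) ≤ 0 := by
  have := hA.rep_single_nonneg cs (w := w * cs.simple i) (i := i)
    (by rw [cs.simple_mul_simple_cancel_right]; omega)
  rwa [hA.rep_mul_simple_self, neg_nonneg] at this

theorem IsCartan.ascent_iff {w : W} {i : B} :
    cs.length (w * cs.simple i) = cs.length w + 1 ↔ 0 ≤ hA.rep cs w (Pi.single i 1) := by
  refine ⟨hA.rep_single_nonneg cs, fun h => ?_⟩
  refine (cs.length_mul_simple w i).resolve_right fun hc => ?_
  exact hA.rep_single_ne_zero cs w i (le_antisymm (hA.rep_single_nonpos cs hc) h)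

theorem IsCartan.descent_iff {w : W} {i : B} :
    cs.length (w * cs.simple i) + 1 = cs.length w ↔ hA.rep cs w (Pi.single i 1) ≤ 0 := by
  refine ⟨hA.rep_single_nonpos cs, fun h => ?_⟩
  refine (cs.length_mul_simple w i).resolve_left fun hc => ?_
  exact hA.rep_single_ne_zero cs w i (le_antisymm h (hA.rep_single_nonneg cs hc))

theorem IsCartan.nonneg_or_nonpos (w : W) (i : B) :
    0 ≤ hA.rep cs w (Pi.single i 1) ∨ hA.rep cs w (Pi.single i 1) ≤ 0 := by
  rw [← hA.ascent_iff cs, ← hA.descent_iff cs]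
  exact cs.length_mul_simple w i

end Tits

/-! ### Parabolic subgroups, minimal coset representatives and weighted lengths -/

section Parabolic

variable {B W : Type*} [Group W] {M : CoxeterMatrix B} (cs : CoxeterSystem M W)

/-- The elements all of whose right multiplications by simple reflections in `J` are ascents. -/
def ascOn (J : Set B) : Set W := {w | ∀ s ∈ J, cs.length (w * cs.simple s) = cs.length w + 1}

/-- The elements all of whose right multiplications by simple reflections in `J` are descents. -/
def descOn (J : Set B) : Set W := {w | ∀ s ∈ J, cs.length (w * cs.simple s) + 1 = cs.length w}

/-- `L` is a weighted length function: it grows by `wt s` along every ascent by `s`. -/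
structure IsWeight (wt : B → ℕ) (L : W → ℕ) : Prop where
  one : L 1 = 0
  mul_simple : ∀ w s, cs.length (w * cs.simple s) = cs.length w + 1 →
    L (w * cs.simple s) = L w + wt s
  inv : ∀ w, L w⁻¹ = L w

theorem isWeight_length : IsWeight cs (fun _ => 1) cs.length where
  one := cs.length_one
  mul_simple _ _ h := h
  inv := cs.length_inv

theorem simple_mem_parabolic {J : Set B} {s : B} (hs : s ∈ J) : cs.simple s ∈ parabolic cs J :=
  Subgroup.subset_closure ⟨s, hs, rfl⟩

theorem parabolic_mono {J K : Set B} (h : J ⊆ K) : parabolic cs J ≤ parabolic cs K :=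
  Subgroup.closure_mono (Set.image_mono h)

variable {cs} in
theorem IsWeight.mul_simple_descent {wt : B → ℕ} {L : W → ℕ} (hL : IsWeight cs wt L) {w : W} {s : B}
    (h : cs.length (w * cs.simple s) + 1 = cs.length w) : L (w * cs.simple s) + wt s = L w := by
  have := hL.mul_simple (w * cs.simple s) s (by simp [h])
  simpa using this.symm

variable {cs} in
theorem IsWeight.length_le {wt : B → ℕ} {L : W → ℕ} (hL : IsWeight cs wt L) (hwt : ∀ s, 0 < wt s)
    (w : W) : cs.length w ≤ L w := by
  induction hl : cs.length w using Nat.strong_induction_on generalizing w with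
  | _ l ih =>
  subst hl
  by_cases hw : w = 1
  · simp [hw]
  obtain ⟨s, hs⟩ := cs.exists_rightDescent_of_ne_one hw
  rw [cs.isRightDescent_iff] at hs
  have h1 := ih _ (by omega) (w * cs.simple s) rfl
  have h2 := hL.mul_simple_descent hs
  have := hwt s
  omega

variable {cs} in
theorem IsWeight.finite_fibre [Finite B] {wt : B → ℕ} {L : W → ℕ} (hL : IsWeight cs wt L)
    (hwt : ∀ s, 0 < wt s) (k : ℕ) : {w | L w = k}.Finite := by
  refine ((Set.finite_Iic k).biUnion fun i _ => finite_length_eq cs ⊤ i).subset ?_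
  rintro w rfl
  simpa using hL.length_le hwt w

/-- Every coset of a parabolic subgroup has a representative without descents in `J`. -/
theorem exists_ascOn_mul (J : Set B) (w : W) :
    ∃ u ∈ ascOn cs J, ∃ v ∈ parabolic cs J, w = u * v := by
  induction hl : cs.length w using Nat.strong_induction_on generalizing w with
  | _ l ih =>
  subst hl
  by_cases hw : w ∈ ascOn cs J
  · exact ⟨w, hw, 1, one_mem _, by simp⟩
  simp only [ascOn, Set.mem_ofPred_eq, not_forall] at hw
  obtain ⟨s, hs, h⟩ := hw
  have h' := (cs.length_mul_simple w s).resolve_left h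
  obtain ⟨u, hu, v, hv, huv⟩ := ih _ (by omega) (w * cs.simple s) rfl
  exact ⟨u, hu, v * cs.simple s, mul_mem hv (simple_mem_parabolic cs hs),
    by rw [← mul_assoc, ← huv]; simp⟩

theorem mem_ascOn_union {J K : Set B} {w : W} :
    w ∈ ascOn cs (J ∪ K) ↔ w ∈ ascOn cs J ∧ w ∈ ascOn cs K := by
  simp [ascOn, or_imp, forall_and]

end Parabolic

section ParabolicRoots

variable {B W : Type*} [Fintype B] [DecidableEq B] [Group W] {M : CoxeterMatrix B}
  {A : B → B → ℤ} (hA : IsCartan M A) (cs : CoxeterSystem M W)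

theorem IsCartan.rep_apply_of_notMem {J : Set B} {v : W} (hv : v ∈ parabolic cs J) {t : B}
    (ht : t ∉ J) (x : B → ℤ) : hA.rep cs v x t = x t := by
  induction hv using Subgroup.closure_induction generalizing x with
  | mem v hv =>
    obtain ⟨s, hs, rfl⟩ := hv
    rw [hA.rep_simple, rootReflection_apply_of_ne]
    rintro rfl
    exact ht hs
  | one => simp
  | mul v w _ _ hv hw => rw [hA.rep_mul_apply, hv, hw]
  | inv v _ hv => rw [← hv (hA.rep cs v⁻¹ x), hA.rep_apply_rep_inv]

theorem IsCartan.rep_single_of_orthogonal {J : Set B} {v : W} (hv : v ∈ parabolic cs J) {t : B}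
    (ht : ∀ s ∈ J, A s t = 0) : hA.rep cs v (Pi.single t 1) = Pi.single t 1 := by
  induction hv using Subgroup.closure_induction with
  | mem v hv =>
    obtain ⟨s, hs, rfl⟩ := hv
    rw [hA.rep_simple, rootReflection_single, ht s hs]
    simp
  | one => simp
  | mul v w _ _ hv hw => rw [hA.rep_mul_apply, hw, hv]
  | inv v _ hv => nth_rw 1 [← hv, hA.rep_inv_apply_rep]

/-- Reflections in J leave the coordinates outside J unchanged. So for s outside J the vector v α_s
keeps the coordinate 1 at s, and s cannot be a descent. -/
theorem IsCartan.exists_descent (hA : IsCartan M A)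
    {J : Set B} {v : W} (hv : v ∈ parabolic cs J) (h1 : v ≠ 1) :
    ∃ s ∈ J, cs.length (v * cs.simple s) + 1 = cs.length v := by
  obtain ⟨s, hs⟩ := cs.exists_rightDescent_of_ne_one h1
  rw [cs.isRightDescent_iff] at hs
  refine ⟨s, ?_, hs⟩
  by_contra hsJ
  have h2 := (hA.descent_iff cs).1 hs s
  rw [hA.rep_apply_of_notMem cs hv hsJ] at h2
  simp at h2

theorem IsCartan.rep_apply_eq_sum (w : W) (x : B → ℤ) :
    hA.rep cs w x = ∑ i, x i • hA.rep cs w (Pi.single i 1) := by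
  conv_lhs => rw [show x = ∑ i, x i • Pi.single i (1 : ℤ) by
    ext j; simp [Finset.sum_apply, Pi.single_apply]]
  simp only [map_sum, map_smul]

theorem IsCartan.rep_nonneg_of_ascOn {J : Set B} {u : W} (hu : u ∈ ascOn cs J) {x : B → ℤ}
    (hx : 0 ≤ x) (hxJ : ∀ t ∉ J, x t = 0) : 0 ≤ hA.rep cs u x := by
  rw [hA.rep_apply_eq_sum]
  refine Finset.sum_nonneg fun i _ => ?_
  by_cases hi : i ∈ J
  · exact smul_nonneg (hx i) ((hA.ascent_iff cs).1 (hu i hi))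
  · simp [hxJ i hi]

theorem IsCartan.rep_nonpos_of_descOn {J : Set B} {u : W} (hu : u ∈ descOn cs J) {x : B → ℤ}
    (hx : 0 ≤ x) (hxJ : ∀ t ∉ J, x t = 0) : hA.rep cs u x ≤ 0 := by
  rw [hA.rep_apply_eq_sum]
  refine Finset.sum_nonpos fun i _ => ?_
  by_cases hi : i ∈ J
  · exact smul_nonpos_of_nonneg_of_nonpos (hx i) ((hA.descent_iff cs).1 (hu i hi))
  · simp [hxJ i hi]

theorem IsCartan.rep_single_apply_of_notMem {J : Set B} {v : W} (hv : v ∈ parabolic cs J) {s : B}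
    (hs : s ∈ J) : ∀ t ∉ J, hA.rep cs v (Pi.single s 1) t = 0 := by
  intro t ht
  rw [hA.rep_apply_of_notMem cs hv ht, Pi.single_eq_of_ne]
  rintro rfl
  exact ht hs

variable {wt : B → ℕ} {L : W → ℕ}

/-- Removing descents of v one at a time reduces to one step: if v' ascends at s, then v' α_s is a
nonnegative combination of simple roots of J, and u keeps it nonnegative, so u v' ascends at s too.
-/
theorem IsCartan.weight_mul_of_ascOn (hA : IsCartan M A) (hL : IsWeight cs wt L)
    {J : Set B} {u v : W} (hu : u ∈ ascOn cs J)
    (hv : v ∈ parabolic cs J) : L (u * v) = L u + L v := by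
  induction hl : cs.length v using Nat.strong_induction_on generalizing v with
  | _ l ih =>
  subst hl
  by_cases h1 : v = 1
  · simp [h1, hL.one]
  obtain ⟨s, hs, h⟩ := hA.exists_descent cs hv h1
  have hv' := mul_mem hv (simple_mem_parabolic cs hs)
  have h2 := ih _ (by omega) hv' rfl
  have h3 : cs.length (v * cs.simple s * cs.simple s) = cs.length (v * cs.simple s) + 1 := by
    simp [h]
  have h4 := (hA.ascent_iff cs).2 <| (hA.rep_mul_apply cs u (v * cs.simple s) (Pi.single s 1)).symm ▸
    hA.rep_nonneg_of_ascOn cs hu ((hA.ascent_iff cs).1 h3)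
      (hA.rep_single_apply_of_notMem cs hv' hs)
  have h5 := hL.mul_simple _ _ h4
  have h6 := hL.mul_simple _ _ h3
  simp only [mul_assoc, cs.simple_mul_simple_self, mul_one] at *
  omega

/-- The mirror image of `IsCartan.weight_mul_of_ascOn`: u makes nonnegative combinations of the
simple roots of J nonpositive, so each letter of v lowers the weight. -/
theorem IsCartan.weight_mul_of_descOn (hA : IsCartan M A) (hL : IsWeight cs wt L)
    {J : Set B} {u v : W} (hu : u ∈ descOn cs J)
    (hv : v ∈ parabolic cs J) : L (u * v) + L v = L u := by
  induction hl : cs.length v using Nat.strong_induction_on generalizing v with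
  | _ l ih =>
  subst hl
  by_cases h1 : v = 1
  · simp [h1, hL.one]
  obtain ⟨s, hs, h⟩ := hA.exists_descent cs hv h1
  have hv' := mul_mem hv (simple_mem_parabolic cs hs)
  have h2 := ih _ (by omega) hv' rfl
  have h3 : cs.length (v * cs.simple s * cs.simple s) = cs.length (v * cs.simple s) + 1 := by
    simp [h]
  have h4 := (hA.descent_iff cs).2 <| (hA.rep_mul_apply cs u (v * cs.simple s) (Pi.single s 1)).symm ▸
    hA.rep_nonpos_of_descOn cs hu ((hA.ascent_iff cs).1 h3)
      (hA.rep_single_apply_of_notMem cs hv' hs)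
  have h5 := hL.mul_simple_descent h4
  have h6 := hL.mul_simple _ _ h3
  simp only [mul_assoc, cs.simple_mul_simple_self, mul_one] at *
  omega

/-- Two minimal representatives of one coset differ by some g in W_J; additivity of length in both
directions forces ℓ(g) = 0. -/
theorem IsCartan.eq_of_ascOn (hA : IsCartan M A) {J : Set B} {u u' v v' : W} (hu : u ∈ ascOn cs J)
    (hu' : u' ∈ ascOn cs J) (hv : v ∈ parabolic cs J) (hv' : v' ∈ parabolic cs J)
    (h : u * v = u' * v') : u = u' ∧ v = v' := by
  have hg : v * v'⁻¹ ∈ parabolic cs J := mul_mem hv (inv_mem hv')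
  have h1 : u' = u * (v * v'⁻¹) := by rw [← mul_assoc, h]; simp
  have h2 : u = u' * (v * v'⁻¹)⁻¹ := by rw [h1]; group
  have h3 := hA.weight_mul_of_ascOn cs (isWeight_length cs) hu hg
  have h4 := hA.weight_mul_of_ascOn cs (isWeight_length cs) hu' (inv_mem hg)
  rw [← h1] at h3
  rw [← h2] at h4
  have h5 : v * v'⁻¹ = 1 := cs.length_eq_zero_iff.1 (by omega)
  have h6 : v = v' := mul_inv_eq_one.1 h5
  subst h6
  exact ⟨by simpa using h, rfl⟩

theorem IsCartan.eq_of_descOn (hA : IsCartan M A) {J : Set B} {w w' : W} (hw : w ∈ descOn cs J)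
    (hw' : w' ∈ descOn cs J) (hwJ : w ∈ parabolic cs J) (hwJ' : w' ∈ parabolic cs J) : w = w' := by
  have hg : w⁻¹ * w' ∈ parabolic cs J := mul_mem (inv_mem hwJ) hwJ'
  have h3 := hA.weight_mul_of_descOn cs (isWeight_length cs) hw hg
  have h4 := hA.weight_mul_of_descOn cs (isWeight_length cs) hw' (inv_mem hg)
  simp only [mul_inv_cancel_left, mul_inv_rev, inv_inv] at h3 h4
  have h5 : w⁻¹ * w' = 1 := cs.length_eq_zero_iff.1 (by omega)
  exact inv_mul_eq_one.1 h5

/-- An element of `W_J` without ascents in `J` is the longest element of `W_J`. -/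
theorem IsCartan.isLongestElement (hA : IsCartan M A) {J : Set B} {w : W} (hw : w ∈ descOn cs J)
    (hwJ : w ∈ parabolic cs J) : IsLongestElement cs (parabolic cs J) w := by
  refine ⟨hwJ, fun v hv hne => ?_⟩
  have hg : w⁻¹ * v ∈ parabolic cs J := mul_mem (inv_mem hwJ) hv
  have h3 := hA.weight_mul_of_descOn cs (isWeight_length cs) hw hg
  rw [mul_inv_cancel_left] at h3
  have : cs.length (w⁻¹ * v) ≠ 0 := fun h =>
    hne (inv_mul_eq_one.1 (cs.length_eq_zero_iff.1 h)).symm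
  omega

theorem IsCartan.finite_parabolic (hA : IsCartan M A) {J : Set B} {w : W} (hw : w ∈ descOn cs J)
    (hwJ : w ∈ parabolic cs J) : (parabolic cs J : Set W).Finite := by
  refine ((Set.finite_Iic (cs.length w)).biUnion fun i _ => finite_length_eq cs ⊤ i).subset ?_
  intro v hv
  have hg : w⁻¹ * v ∈ parabolic cs J := mul_mem (inv_mem hwJ) hv
  have h3 := hA.weight_mul_of_descOn cs (isWeight_length cs) hw hg
  rw [mul_inv_cancel_left] at h3
  simp only [Set.mem_iUnion, Set.mem_Iic, Set.mem_ofPred_eq, Subgroup.mem_top, true_and]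
  exact ⟨cs.length v, by omega, rfl⟩

theorem IsCartan.mem_ascOn_of_orthogonal (hA : IsCartan M A)
    {J K : Set B} (hJK : ∀ s ∈ J, ∀ t ∈ K, A s t = 0) {w : W}
    (hw : w ∈ parabolic cs J) : w ∈ ascOn cs K := by
  intro t ht
  rw [hA.ascent_iff, hA.rep_single_of_orthogonal cs hw fun s hs => hJK s hs t ht]
  simp

/-- Any descent of w lies in J, and removing it keeps the ascents along K because that reflection
fixes the simple roots of K. -/
theorem IsCartan.mem_parabolic_of_ascOn (hA : IsCartan M A)
    {J K : Set B} (hJK : ∀ s ∈ J, ∀ t ∈ K, A s t = 0) {w : W}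
    (hw : w ∈ parabolic cs (J ∪ K)) (hwK : w ∈ ascOn cs K) : w ∈ parabolic cs J := by
  induction hl : cs.length w using Nat.strong_induction_on generalizing w with
  | _ l ih =>
  subst hl
  by_cases h1 : w = 1
  · simp [h1]
  obtain ⟨s, hs, h⟩ := hA.exists_descent cs hw h1
  have hsJ : s ∈ J := by
    refine hs.resolve_right fun hsK => ?_
    have := hwK s hsK
    omega
  have h2 := ih _ (by omega) (mul_mem hw (simple_mem_parabolic cs hs)) (fun t ht => by
    rw [hA.ascent_iff, hA.rep_mul_simple, hJK s hsJ t ht, zero_smul, sub_zero, ← hA.ascent_iff]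
    exact hwK t ht) rfl
  simpa using mul_mem h2 (simple_mem_parabolic cs hsJ)

end ParabolicRoots

/-! ### Generating series by weight -/

section Series

variable {α : Type*} (L : α → ℕ)

/-- The generating series `∑_{x ∈ S} X ^ L x`. -/
noncomputable def ser (S : Set α) : ℚ⟦X⟧ := PowerSeries.mk fun k => ({x | x ∈ S ∧ L x = k}.ncard : ℚ)

theorem coeff_ser (S : Set α) (k : ℕ) : coeff k (ser L S) = ({x | x ∈ S ∧ L x = k}.ncard : ℚ) :=
  coeff_mk _ _

theorem ser_singleton (a : α) : ser L {a} = X ^ L a := by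
  ext k
  rw [coeff_ser, coeff_X_pow]
  split_ifs with h
  · have : {x | x ∈ ({a} : Set α) ∧ L x = k} = {a} := by
      ext x; simp +contextual [h]
    rw [this]; simp
  · have : {x | x ∈ ({a} : Set α) ∧ L x = k} = ∅ := by
      ext x; simp only [Set.mem_singleton_iff, Set.mem_ofPred_eq, Set.mem_empty_iff_false, iff_false]
      rintro ⟨rfl, h'⟩; exact h h'.symm
    rw [this]; simp

theorem ser_empty : ser L ∅ = 0 := by
  ext k
  simp [coeff_ser]

variable {L}

theorem ser_union (hfin : ∀ k, {x | L x = k}.Finite) {S T : Set α} (h : Disjoint S T) :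
    ser L (S ∪ T) = ser L S + ser L T := by
  ext k
  rw [map_add, coeff_ser, coeff_ser, coeff_ser, ← Nat.cast_add, ← Set.ncard_union_eq ?_
    ((hfin k).subset fun x hx => hx.2) ((hfin k).subset fun x hx => hx.2)]
  · congr 2
    ext x
    simp [or_and_right]
  · rw [Set.disjoint_left] at h ⊢
    exact fun x hx hx' => h hx.1 hx'.1

/-- Unique factorization with additive weights, read coefficientwise as a bijection with pairs
graded by the antidiagonal. -/
theorem ser_mul {G : Type*} [Mul G] {L : G → ℕ} (hfin : ∀ k, {x | L x = k}.Finite) {S T U : Set G}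
    (hU : ∀ w, w ∈ U ↔ ∃ u ∈ S, ∃ v ∈ T, w = u * v)
    (hL : ∀ u ∈ S, ∀ v ∈ T, L (u * v) = L u + L v)
    (hinj : ∀ u ∈ S, ∀ u' ∈ S, ∀ v ∈ T, ∀ v' ∈ T, u * v = u' * v' → u = u' ∧ v = v') :
    ser L U = ser L S * ser L T := by
  classical
  have hf : ∀ (V : Set G) k, {x | x ∈ V ∧ L x = k}.Finite :=
    fun V k => (hfin k).subset fun x hx => hx.2
  ext k
  rw [coeff_mul]
  simp only [coeff_ser, Set.ncard_eq_toFinset_card _ (hf _ _)]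
  norm_cast
  simp only [← Finset.card_product]
  rw [← Finset.card_sigma]
  symm
  refine Finset.card_bij (fun p _ => p.2.1 * p.2.2) ?_ ?_ ?_
  · rintro ⟨⟨i, j⟩, u, v⟩ h
    simp only [Finset.mem_sigma, Finset.mem_product,
      Set.Finite.mem_toFinset, Set.mem_ofPred_eq] at h ⊢
    obtain ⟨hk, ⟨hu, rfl⟩, hv, rfl⟩ := h
    exact ⟨(hU _).2 ⟨u, hu, v, hv, rfl⟩, by rw [hL u hu v hv, Finset.HasAntidiagonal.mem_antidiagonal.1 hk]⟩
  · rintro ⟨⟨i, j⟩, u, v⟩ h ⟨⟨i', j'⟩, u', v'⟩ h' he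
    simp only [Finset.mem_sigma, Finset.mem_product,
      Set.Finite.mem_toFinset, Set.mem_ofPred_eq] at h h' he
    obtain ⟨hk, ⟨hu, rfl⟩, hv, rfl⟩ := h
    obtain ⟨hk', ⟨hu', rfl⟩, hv', rfl⟩ := h'
    obtain ⟨rfl, rfl⟩ := hinj u hu u' hu' v hv v' hv' he
    rfl
  · intro w hw
    simp only [Set.Finite.mem_toFinset, Set.mem_ofPred_eq] at hw
    obtain ⟨hw, rfl⟩ := hw
    obtain ⟨u, hu, v, hv, rfl⟩ := (hU w).1 hw
    refine ⟨⟨(L u, L v), (u, v)⟩, ?_, rfl⟩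
    simp [hu, hv, hL u hu v hv]

theorem ser_image_finset {ι : Type*} {S : Set α} (X' : Finset ι) (f : ι → α)
    (hS : S = f '' X') (hf : Set.InjOn f X') :
    ser L S = ∑ x ∈ X', X ^ L (f x) := by
  classical
  ext k
  rw [coeff_ser, map_sum]
  simp only [coeff_X_pow]
  rw [Finset.sum_boole]
  congr 1
  have : {x | x ∈ S ∧ L x = k} = f '' (X'.filter fun x => k = L (f x) : Finset ι) := by
    ext x
    simp only [hS, Set.mem_ofPred_eq, Finset.coe_filter, Set.mem_image]
    constructor
    · rintro ⟨⟨i, hi, rfl⟩, h⟩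
      exact ⟨i, ⟨hi, h.symm⟩, rfl⟩
    · rintro ⟨i, ⟨hi, h⟩, rfl⟩
      exact ⟨⟨i, hi, rfl⟩, h.symm⟩
  rw [this, (hf.mono (Finset.coe_subset.2 (Finset.filter_subset _ _))).ncard_image, Set.ncard_coe_finset]

end Series

/-! ### Factorizations of Poincaré series -/

section CoxeterSeries

variable {B W : Type*} [Fintype B] [DecidableEq B] [Group W] {M : CoxeterMatrix B}
  {A : B → B → ℤ} (cs : CoxeterSystem M W) {wt : B → ℕ} {L : W → ℕ}

theorem IsCartan.ser_parabolic (hA : IsCartan M A) (hL : IsWeight cs wt L) (hwt : ∀ s, 0 < wt s)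
    {J K : Set B} (hKJ : K ⊆ J) :
    ser L (parabolic cs J : Set W) =
      ser L (parabolic cs J ∩ ascOn cs K) * ser L (parabolic cs K : Set W) := by
  refine ser_mul (hL.finite_fibre hwt) ?_ ?_ ?_
  · intro w
    constructor
    · intro hw
      obtain ⟨u, hu, v, hv, rfl⟩ := exists_ascOn_mul cs K w
      refine ⟨u, ⟨?_, hu⟩, v, hv, rfl⟩
      simpa using mul_mem hw (inv_mem (parabolic_mono cs hKJ hv))
    · rintro ⟨u, ⟨hu, -⟩, v, hv, rfl⟩
      exact mul_mem hu (parabolic_mono cs hKJ hv)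
  · rintro u ⟨-, hu⟩ v hv
    exact hA.weight_mul_of_ascOn cs hL hu hv
  · rintro u ⟨-, hu⟩ u' ⟨-, hu'⟩ v hv v' hv' h
    exact hA.eq_of_ascOn cs hu hu' hv hv' h

theorem IsCartan.ser_univ (hA : IsCartan M A) (hL : IsWeight cs wt L) (hwt : ∀ s, 0 < wt s)
    (K : Set B) :
    ser L Set.univ = ser L (ascOn cs K) * ser L (parabolic cs K : Set W) := by
  refine ser_mul (hL.finite_fibre hwt) ?_ ?_ ?_
  · intro w
    simpa using exists_ascOn_mul cs K w
  · intro u hu v hv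
    exact hA.weight_mul_of_ascOn cs hL hu hv
  · intro u hu u' hu' v hv v' hv' h
    exact hA.eq_of_ascOn cs hu hu' hv hv' h

/-- For orthogonal J and K, the minimal representatives of W_K in W_{J ∪ K} are exactly the elements
of W_J. -/
theorem IsCartan.ser_parabolic_union (hA : IsCartan M A) (hL : IsWeight cs wt L)
    (hwt : ∀ s, 0 < wt s) {J K : Set B} (hJK : ∀ s ∈ J, ∀ t ∈ K, A s t = 0) :
    ser L (parabolic cs (J ∪ K) : Set W) =
      ser L (parabolic cs J : Set W) * ser L (parabolic cs K : Set W) := by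
  rw [hA.ser_parabolic cs hL hwt (K := K) Set.subset_union_right]
  congr 2
  ext w
  constructor
  · rintro ⟨h1, h2⟩
    exact hA.mem_parabolic_of_ascOn cs hJK h1 h2
  · intro h
    exact ⟨parabolic_mono cs Set.subset_union_left h, hA.mem_ascOn_of_orthogonal cs hJK h⟩

/-- Write w = u v with u minimal for W_K. Descending along all of K forces v to be the longest
element of W_K, and by orthogonality v does not affect the ascents along I. -/
theorem IsCartan.ser_ascOn_inter_descOn (hA : IsCartan M A) (hL : IsWeight cs wt L)
    (hwt : ∀ s, 0 < wt s) {I K : Set B} (hKI : ∀ s ∈ K, ∀ t ∈ I, A s t = 0) {w₀ : W}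
    (hw₀ : w₀ ∈ descOn cs K) (hw₀K : w₀ ∈ parabolic cs K) :
    ser L (ascOn cs I ∩ descOn cs K) = ser L (ascOn cs (I ∪ K)) * X ^ L w₀ := by
  rw [← ser_singleton]
  have hfix : ∀ v ∈ parabolic cs K, ∀ i ∈ I, ∀ u,
      hA.rep cs (u * v) (Pi.single i 1) = hA.rep cs u (Pi.single i 1) := by
    intro v hv i hi u
    rw [hA.rep_mul_apply, hA.rep_single_of_orthogonal cs hv fun s hs => hKI s hs i hi]
  refine ser_mul (hL.finite_fibre hwt) ?_ ?_ ?_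
  · intro w
    constructor
    · rintro ⟨hwI, hwK⟩
      obtain ⟨u, hu, v, hv, rfl⟩ := exists_ascOn_mul cs K w
      have hvd : v ∈ descOn cs K := by
        intro s hs
        refine (cs.length_mul_simple v s).resolve_left fun hc => ?_
        have h1 := hA.rep_nonneg_of_ascOn cs hu ((hA.ascent_iff cs).1 hc)
          (hA.rep_single_apply_of_notMem cs hv hs)
        rw [← hA.rep_mul_apply, ← hA.ascent_iff] at h1
        have := hwK s hs
        omega
      refine ⟨u, (mem_ascOn_union cs).2 ⟨fun i hi => ?_, hu⟩, v,
        hA.eq_of_descOn cs hvd hw₀ hv hw₀K, rfl⟩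
      rw [hA.ascent_iff, ← hfix v hv i hi, ← hA.ascent_iff]
      exact hwI i hi
    · rintro ⟨u, hu, v, rfl, rfl⟩
      rw [mem_ascOn_union] at hu
      refine ⟨fun i hi => ?_, fun s hs => ?_⟩
      · rw [hA.ascent_iff, hfix v hw₀K i hi, ← hA.ascent_iff]
        exact hu.1 i hi
      · have h1 := hA.rep_nonneg_of_ascOn cs hu.2
          (neg_nonneg.2 ((hA.descent_iff cs).1 (hw₀ s hs)))
          (fun t ht => by simp [hA.rep_single_apply_of_notMem cs hw₀K hs t ht])
        rwa [map_neg, neg_nonneg, ← hA.rep_mul_apply, ← hA.descent_iff] at h1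
  · rintro u hu v rfl
    rw [mem_ascOn_union] at hu
    exact hA.weight_mul_of_ascOn cs hL hu.2 hw₀K
  · rintro u - u' - v rfl v' rfl h
    exact ⟨by simpa using h, rfl⟩

end CoxeterSeries

/-- The longest element of a finite parabolic subgroup, from the degree of its series. -/
theorem IsWeight.exists_longest {B W : Type*} [Finite B] [Group W] {M : CoxeterMatrix B}
    (cs : CoxeterSystem M W) {wt : B → ℕ} {L : W → ℕ} (hL : IsWeight cs wt L)
    (hwt : ∀ s, 0 < wt s) {K : Set B} {N : ℕ} (h1 : coeff N (ser L (parabolic cs K : Set W)) ≠ 0)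
    (h2 : ∀ k, N < k → coeff k (ser L (parabolic cs K : Set W)) = 0) :
    ∃ w₀ ∈ descOn cs K, w₀ ∈ parabolic cs K ∧ L w₀ = N := by
  rw [coeff_ser] at h1
  obtain ⟨w, hw, hN⟩ := Set.nonempty_of_ncard_ne_zero (Nat.cast_ne_zero.1 h1)
  refine ⟨w, fun s hs => ?_, hw, hN⟩
  refine (cs.length_mul_simple w s).resolve_left fun hc => ?_
  have h3 := hL.mul_simple w s hc
  -- An ascent inside K would produce an element of W_K of weight beyond the top degree N.
  have h4 := h2 (L w + wt s) (by have := hwt s; omega)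
  rw [coeff_ser, Nat.cast_eq_zero, Set.ncard_eq_zero
    ((hL.finite_fibre hwt (L w + wt s)).subset fun x hx => hx.2)] at h4
  exact Set.notMem_empty (w * cs.simple s)
    (h4 ▸ ⟨mul_mem hw (simple_mem_parabolic cs hs), h3⟩)

/-! ### Counting coset representatives by the orbit of a dominant vector -/

section Orbit

variable {B W : Type*} [Fintype B] [DecidableEq B] [Group W] {M : CoxeterMatrix B}
  {A : B → B → ℤ} (cs : CoxeterSystem M W) {wt : B → ℕ} {L : W → ℕ}

/-- On the span of the simple roots of J, passing from ξ x to ξ y is the transpose of s. This is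
what identifies the abstract move on ι with the group action. -/
theorem pairing_rootReflection {ι : Type*} (hA : IsCartan M A) {J : Set B} {ξ : ι → B → ℤ}
    {x y : ι} {s : B} (hs : s ∈ J) (h : ∀ t ∈ J, ξ y t = ξ x t - A s t * ξ x s) {v : B → ℤ}
    (hv : ∀ t ∉ J, v t = 0) : pairing ξ y (rootReflection A s v) = pairing ξ x v := by
  have h1 : pairing ξ y v = pairing ξ x v - ξ x s * pairing A s v := by
    simp only [pairing_apply, Finset.mul_sum, ← Finset.sum_sub_distrib]
    refine Finset.sum_congr rfl fun t _ => ?_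
    by_cases ht : t ∈ J
    · rw [h t ht]; ring
    · simp [hv t ht]
  rw [rootReflection_apply, map_sub, map_smul, pairing_single, h s hs, h1, hA.diag, smul_eq_mul]
  ring

/-- At a descent s of g, dominance gives ξ(g α_s) ≤ 0, while invariance gives ξ(g α_s) = ξ(α_s) ≥ 0.
So ξ vanishes at s, which lies in K and can be removed from g. -/
theorem IsCartan.mem_parabolic_of_stabilizes (hA : IsCartan M A) {J K : Set B} {ξ : B → ℤ}
    (hξ : ∀ s ∈ J, 0 ≤ ξ s) (hK : ∀ s ∈ J, ξ s = 0 → s ∈ K) {g : W} (hg : g ∈ parabolic cs J)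
    (h : ∀ v : B → ℤ, (∀ t ∉ J, v t = 0) →
      pairing (fun _ : Unit => ξ) () (hA.rep cs g v) = pairing (fun _ : Unit => ξ) () v) :
    g ∈ parabolic cs K := by
  induction hl : cs.length g using Nat.strong_induction_on generalizing g with
  | _ l ih =>
  subst hl
  by_cases h1 : g = 1
  · simp [h1]
  obtain ⟨s, hs, hd⟩ := hA.exists_descent cs hg h1
  have hsupp : ∀ t ∉ J, (Pi.single s 1 : B → ℤ) t = 0 := by
    intro t ht
    rw [Pi.single_eq_of_ne]
    rintro rfl
    exact ht hs
  have h2 := h (Pi.single s 1) hsupp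
  rw [pairing_single] at h2
  have h3 : pairing (fun _ : Unit => ξ) () (hA.rep cs g (Pi.single s 1)) ≤ 0 := by
    rw [pairing_apply]
    refine Finset.sum_nonpos fun t _ => ?_
    by_cases ht : t ∈ J
    · exact mul_nonpos_of_nonneg_of_nonpos (hξ t ht) ((hA.descent_iff cs).1 hd t)
    · simp [hA.rep_single_apply_of_notMem cs hg hs t ht]
  have h4 : ξ s = 0 := le_antisymm (h2 ▸ h3) (hξ s hs)
  have h5 := ih _ (by omega) (mul_mem hg (simple_mem_parabolic cs hs)) (fun v hv => by
    rw [hA.rep_mul_apply, hA.rep_simple, h, pairing_rootReflection hA hs _ hv]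
    · simp [h4]
    · intro t ht
      rw [rootReflection_apply_of_ne, hv t ht]
      rintro rfl
      exact ht hs) rfl
  simpa using mul_mem h5 (simple_mem_parabolic cs (hK s hs h4))

/-- The series of the minimal coset representatives of `W_K` in `W_J`, where `W_K` is the stabilizer
of a dominant vector `ξ x₀`, computed from the orbit of that vector. -/
theorem IsCartan.ser_orbit (hA : IsCartan M A) (hL : IsWeight cs wt L)
    {J K : Set B} (hKJ : K ⊆ J) {ι : Type*} (O : Finset ι) (ξ : ι → B → ℤ)
    (a : B → ι → ι) (h : ι → ℕ) {x₀ : ι} (hx₀ : x₀ ∈ O)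
    (ha_mem : ∀ s ∈ J, ∀ x ∈ O, a s x ∈ O) (ha_inv : ∀ s ∈ J, ∀ x ∈ O, a s (a s x) = x)
    (hξ : ∀ s ∈ J, ∀ x ∈ O, ∀ t ∈ J, ξ (a s x) t = ξ x t - A s t * ξ x s)
    (hdom : ∀ s ∈ J, 0 ≤ ξ x₀ s) (hK : ∀ s ∈ J, ξ x₀ s = 0 ↔ s ∈ K) (h0 : h x₀ = 0)
    (hdesc : ∀ x ∈ O, x ≠ x₀ → ∃ s ∈ J, ξ x s < 0 ∧ h x = h (a s x) + wt s ∧ 0 < wt s) :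
    ser L (parabolic cs J ∩ ascOn cs K) = ∑ x ∈ O, X ^ h x := by
  -- `R u x` says that x = u x₀, as functionals on the span of the simple roots of J.
  let R : W → ι → Prop := fun u x => ∀ v : B → ℤ, (∀ t ∉ J, v t = 0) →
    pairing ξ x (hA.rep cs u v) = pairing ξ x₀ v
  have hsupp : ∀ s ∈ J, ∀ t ∉ J, (Pi.single s 1 : B → ℤ) t = 0 := by
    intro s hs t ht
    rw [Pi.single_eq_of_ne]
    rintro rfl
    exact ht hs
  have hrsupp : ∀ u ∈ parabolic cs J, ∀ v : B → ℤ, (∀ t ∉ J, v t = 0) →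
      ∀ t ∉ J, hA.rep cs u v t = 0 := by
    intro u hu v hv t ht
    rw [hA.rep_apply_of_notMem cs hu ht, hv t ht]
  have hRstep : ∀ s ∈ J, ∀ x ∈ O, ∀ u ∈ parabolic cs J, R u x → R (cs.simple s * u) (a s x) := by
    intro s hs x hx u hu hR v hv
    rw [hA.rep_mul_apply, hA.rep_simple,
      pairing_rootReflection hA hs (hξ s hs x hx) (hrsupp u hu v hv), hR v hv]
  have hexists : ∀ x ∈ O, ∃ u ∈ (parabolic cs J ∩ ascOn cs K : Set W), R u x ∧ L u = h x := by
    intro x hx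
    induction hl : h x using Nat.strong_induction_on generalizing x with
    | _ l ih =>
    subst hl
    by_cases hxx : x = x₀
    · subst hxx
      exact ⟨1, ⟨one_mem _, fun s _ => by simp⟩, fun v _ => by simp, by rw [hL.one, h0]⟩
    obtain ⟨s, hs, hneg, hh, hpos⟩ := hdesc x hx hxx
    obtain ⟨u, ⟨hu, huK⟩, hR, hLu⟩ := ih _ (by omega) (a s x) (ha_mem s hs x hx) rfl
    have hpos : 0 < ξ (a s x) s := by
      rw [hξ s hs x hx s hs, hA.diag]; omega
    -- The functional of a s x is positive on α_s and equals that of x₀ on u⁻¹ α_s; by dominance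
    -- that root is not negative.
    have hasc : cs.length (u⁻¹ * cs.simple s) = cs.length u⁻¹ + 1 := by
      refine (cs.length_mul_simple _ s).resolve_right fun hc => ?_
      have h1 := hR _ (hrsupp _ (inv_mem hu) _ (hsupp s hs))
      rw [hA.rep_apply_rep_inv, pairing_single, pairing_apply] at h1
      have h2 : ∑ j, ξ x₀ j * hA.rep cs u⁻¹ (Pi.single s 1) j ≤ 0 := by
        refine Finset.sum_nonpos fun t _ => ?_
        by_cases ht : t ∈ J
        · exact mul_nonpos_of_nonneg_of_nonpos (hdom t ht) ((hA.descent_iff cs).1 hc t)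
        · simp [hA.rep_single_apply_of_notMem cs (inv_mem hu) hs t ht]
      omega
    refine ⟨cs.simple s * u, ⟨mul_mem (simple_mem_parabolic cs hs) hu, fun k hk => ?_⟩, ?_, ?_⟩
    · rw [hA.ascent_iff]
      refine (hA.nonneg_or_nonpos cs _ k).resolve_right fun hc => ?_
      rw [hA.rep_mul_apply, hA.rep_simple] at hc
      have h1 := (hA.ascent_iff cs).1 (huK k hk)
      -- If s u descended at k in K, then u α_k ≥ 0 and s u α_k ≤ 0 would make u α_k a multiple of
      -- α_s. Pairing with a s x gives 0 for u α_k but a positive number for α_s, a contradiction.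
      have h2 : hA.rep cs u (Pi.single k 1) =
          hA.rep cs u (Pi.single k 1) s • Pi.single s 1 := by
        ext t
        by_cases hts : t = s
        · subst hts; simp
        · have h3 := hc t
          rw [rootReflection_apply_of_ne A hts] at h3
          simp [hts, le_antisymm h3 (h1 t)]
      have h3 := hR _ (hsupp k (hKJ hk))
      rw [h2, map_smul, pairing_single, pairing_single, (hK k (hKJ hk)).2 hk, smul_eq_mul,
        mul_eq_zero] at h3
      rw [h3.resolve_right hpos.ne', zero_smul] at h2
      exact hA.rep_single_ne_zero cs u k h2
    · simpa [ha_inv s hs x hx] using hRstep s hs _ (ha_mem s hs x hx) u hu hR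
    · have h1 := hL.mul_simple _ _ hasc
      -- The orbit is built by left multiplication, whereas weights grow under right multiplication;
      -- invariance of L under inversion bridges the two.
      rw [← hL.inv, mul_inv_rev, cs.inv_simple, inv_inv, hL.inv] at h1
      rw [h1, hLu, hh]
  choose! f hf hfR hfL using hexists
  have huniq : ∀ x, ∀ u ∈ (parabolic cs J ∩ ascOn cs K : Set W),
      ∀ u' ∈ (parabolic cs J ∩ ascOn cs K : Set W), R u x → R u' x → u = u' := by
    rintro x u ⟨hu, huK⟩ u' ⟨hu', huK'⟩ hR hR'
    have hg : u⁻¹ * u' ∈ parabolic cs K := by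
      refine hA.mem_parabolic_of_stabilizes cs (J := J) (ξ := ξ x₀) hdom
        (fun s hs => (hK s hs).1) (mul_mem (inv_mem hu) hu') fun v hv => ?_
      have h1 := hR _ (hrsupp _ (mul_mem (inv_mem hu) hu') v hv)
      rw [← hA.rep_mul_apply, mul_inv_cancel_left, hR' v hv] at h1
      simpa only [pairing_apply] using h1.symm
    exact (hA.eq_of_ascOn cs huK huK' hg (one_mem _) (by simp)).1
  -- Points of O are determined by their coordinates in J: only x₀ has none negative, and a common
  -- reflection lowers h otherwise.
  have hxuniq : ∀ x ∈ O, ∀ y ∈ O, (∀ t ∈ J, ξ x t = ξ y t) → x = y := by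
    intro x hx y hy hxy
    induction hl : h x using Nat.strong_induction_on generalizing x y with
    | _ l ih =>
    subst hl
    by_cases hxx : x = x₀
    · by_contra hne
      obtain ⟨s, hs, hneg, -⟩ := hdesc y hy (by rintro rfl; exact hne hxx)
      rw [← hxy s hs, hxx] at hneg
      exact absurd (hdom s hs) (by omega)
    · obtain ⟨s, hs, hneg, hh, hpos⟩ := hdesc x hx hxx
      have h1 := ih _ (by omega) (a s x) (ha_mem s hs x hx) (a s y) (ha_mem s hs y hy)
        (fun t ht => by rw [hξ s hs x hx t ht, hξ s hs y hy t ht, hxy t ht, hxy s hs]) rfl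
      rw [← ha_inv s hs x hx, h1, ha_inv s hs y hy]
  have htotal : ∀ u ∈ parabolic cs J, ∃ x ∈ O, R u x := by
    intro u hu
    induction hu using Subgroup.closure_induction_left with
    | one => exact ⟨x₀, hx₀, fun v _ => by simp⟩
    | mul_left y hy u hu ih =>
      obtain ⟨s, hs, rfl⟩ := hy
      obtain ⟨x, hx, hR⟩ := ih
      exact ⟨a s x, ha_mem s hs x hx, hRstep s hs x hx u hu hR⟩
    | inv_mul_cancel y hy u hu ih =>
      obtain ⟨s, hs, rfl⟩ := hy
      obtain ⟨x, hx, hR⟩ := ih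
      rw [cs.inv_simple]
      exact ⟨a s x, ha_mem s hs x hx, hRstep s hs x hx u hu hR⟩
  rw [ser_image_finset O f]
  · exact Finset.sum_congr rfl fun x hx => by rw [hfL x hx]
  · ext u
    constructor
    · intro hu
      obtain ⟨x, hx, hR⟩ := htotal u hu.1
      exact ⟨x, hx, huniq x _ (hf x hx) u hu (hfR x hx) hR⟩
    · rintro ⟨x, hx, rfl⟩
      exact hf x hx
  · intro x hx y hy hxy
    refine hxuniq x hx y hy fun t ht => ?_
    have h1 := hfR x hx _ (hrsupp _ (inv_mem (hf x hx).1) _ (hsupp t ht))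
    have h2 := hfR y hy _ (hrsupp _ (inv_mem (hf x hx).1) _ (hsupp t ht))
    rw [hA.rep_apply_rep_inv, pairing_single] at h1
    rw [← hxy, hA.rep_apply_rep_inv, pairing_single] at h2
    rw [h1, h2]

end Orbit

/-! ### Finite types B and D through the vectors ± e_i -/

section Orbits

/-- The sign of a boolean. -/
def boolSign (e : Bool) : ℤ := if e then 1 else -1

/-- The Cartan matrix of the chain `0 ⇒ 1 - 2 - 3 - ⋯`. -/
def cartanB (i j : ℕ) : ℤ :=
  if i = j then 2 else if i = 1 ∧ j = 0 then -2 else if i + 1 = j ∨ j + 1 = i then -1 else 0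

/-- The pairing of the simple roots `2 e_0`, `e_t - e_{t-1}` with the vectors `± e_i`. -/
def orbitB (t : ℕ) (x : ℕ × Bool) : ℤ :=
  boolSign x.2 * if t = 0 then (if x.1 = 0 then 2 else 0) else
    if x.1 = t then 1 else if x.1 + 1 = t then -1 else 0

/-- The action of the simple reflections of type `B` on the vectors `± e_i`. -/
def moveB (t : ℕ) (x : ℕ × Bool) : ℕ × Bool :=
  if t = 0 then (x.1, if x.1 = 0 then !x.2 else x.2) else
    (if x.1 = t then t - 1 else if x.1 + 1 = t then t else x.1, x.2)

theorem moveB_moveB (t : ℕ) (x : ℕ × Bool) : moveB t (moveB t x) = x := by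
  obtain ⟨i, e⟩ := x
  unfold moveB
  rcases Nat.eq_zero_or_pos t with rfl | ht
  · cases e <;> simp
  · simp only [ht.ne', if_false]
    grind

theorem orbitB_moveB (s t : ℕ) (x : ℕ × Bool) :
    orbitB t (moveB s x) = orbitB t x - cartanB s t * orbitB s x := by
  obtain ⟨i, e⟩ := x
  unfold orbitB moveB cartanB boolSign
  rcases Nat.eq_zero_or_pos s with rfl | hs
  · rcases Nat.eq_zero_or_pos t with rfl | ht
    · cases e <;> simp <;> grind
    · cases e <;> simp <;> grind
  · rcases Nat.eq_zero_or_pos t with rfl | ht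
    · cases e <;> simp <;> grind
    · cases e <;> simp <;> grind

/-- The Cartan matrix of the chain `1 - 2 - 3 - ⋯` with a further edge `0 - 2`. -/
def cartanD (i j : ℕ) : ℤ :=
  if i = j then 2 else if i = 0 ∧ j = 2 ∨ i = 2 ∧ j = 0 then -1 else
    if 1 ≤ i ∧ i + 1 = j ∨ 1 ≤ j ∧ j + 1 = i then -1 else 0

/-- The pairing of the simple roots `e_0 + e_1`, `e_t - e_{t-1}` with the vectors `± e_i`. -/
def orbitD (t : ℕ) (x : ℕ × Bool) : ℤ :=
  boolSign x.2 * if t = 0 then (if x.1 ≤ 1 then 1 else 0) else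
    if x.1 = t then 1 else if x.1 + 1 = t then -1 else 0

/-- The action of the simple reflections of type `D` on the vectors `± e_i`. -/
def moveD (t : ℕ) (x : ℕ × Bool) : ℕ × Bool :=
  if t = 0 then (if x.1 ≤ 1 then 1 - x.1 else x.1, if x.1 ≤ 1 then !x.2 else x.2) else
    (if x.1 = t then t - 1 else if x.1 + 1 = t then t else x.1, x.2)

theorem moveD_moveD (t : ℕ) (x : ℕ × Bool) : moveD t (moveD t x) = x := by
  obtain ⟨i, e⟩ := x
  unfold moveD
  rcases Nat.eq_zero_or_pos t with rfl | ht
  · cases e <;> simp <;> grind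
  · simp only [ht.ne', if_false]
    grind

theorem orbitD_moveD (s t : ℕ) (x : ℕ × Bool) :
    orbitD t (moveD s x) = orbitD t x - cartanD s t * orbitD s x := by
  obtain ⟨i, e⟩ := x
  unfold orbitD moveD cartanD boolSign
  rcases Nat.eq_zero_or_pos s with rfl | hs
  · rcases Nat.eq_zero_or_pos t with rfl | ht
    · cases e <;> simp <;> grind
    · cases e <;> simp <;> grind
  · rcases Nat.eq_zero_or_pos t with rfl | ht
    · cases e <;> simp <;> grind
    · cases e <;> simp <;> grind

end Orbits

section Chains

theorem ser_parabolic_empty {B W : Type*} [Group W] {M : CoxeterMatrix B} (cs : CoxeterSystem M W)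
    {wt : B → ℕ} {L : W → ℕ} (hL : IsWeight cs wt L) :
    ser L (parabolic cs ∅ : Set W) = 1 := by
  have : (parabolic cs ∅ : Set W) = {1} := by simp [parabolic]
  rw [this, ser_singleton, hL.one, pow_zero]

/-- The exponents are the heights of ± e_i below the dominant vector e_k: steps of size q down to
e_0, a jump of p to -e_0, then steps of size q again. In type D the jump is 0, since e_0 and -e_0
have equal height. -/
theorem sum_range_prod_bool (k p q : ℕ) :
    ∑ x ∈ Finset.range (k + 1) ×ˢ (Finset.univ : Finset Bool),
      (X : ℚ⟦X⟧) ^ (if x.2 then q * (k - x.1) else q * k + p + q * x.1) =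
      (1 + X ^ p * (X ^ q) ^ k) * qInt (k + 1) (X ^ q) := by
  rw [Finset.sum_product]
  simp only [Fintype.sum_bool, if_true, Bool.false_eq_true, if_false, Finset.sum_add_distrib]
  have h1 : ∑ x ∈ Finset.range (k + 1), (X : ℚ⟦X⟧) ^ (q * (k - x)) = qInt (k + 1) (X ^ q) := by
    rw [← Finset.sum_range_reflect, qInt]
    refine Finset.sum_congr rfl fun i hi => ?_
    rw [Finset.mem_range] at hi
    rw [← pow_mul]
    congr 2
    omega
  rw [h1, add_mul, one_mul, qInt, Finset.mul_sum]
  congr 1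
  refine Finset.sum_congr rfl fun i _ => ?_
  ring

variable {B W : Type*} [Fintype B] [DecidableEq B] [Group W] {M : CoxeterMatrix B}
  {A : B → B → ℤ} (cs : CoxeterSystem M W) {wt : B → ℕ} {L : W → ℕ}

/-- The weighted Poincaré series of a parabolic subgroup of type `B_k`. -/
theorem IsCartan.ser_typeB (hA : IsCartan M A) (hL : IsWeight cs wt L) (hwt : ∀ s, 0 < wt s)
    {S : Set B} {idx : B → ℕ} {n p q : ℕ} (hsurj : ∀ i < n, ∃ s ∈ S, idx s = i)
    (hcartan : ∀ s ∈ S, ∀ t ∈ S, idx s < n → idx t < n → A s t = cartanB (idx s) (idx t))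
    (hp : ∀ s ∈ S, idx s = 0 → wt s = p) (hq : ∀ s ∈ S, idx s < n → idx s ≠ 0 → wt s = q)
    {k : ℕ} (hk : k ≤ n) :
    ser L (parabolic cs {s | s ∈ S ∧ idx s < k} : Set W) =
      ∏ i ∈ Finset.range k, ((1 + X ^ p * (X ^ q) ^ i) * qInt (i + 1) (X ^ q)) := by
  induction k with
  | zero => simpa using ser_parabolic_empty cs hL
  | succ k ih =>
    have hsub : {s | s ∈ S ∧ idx s < k} ⊆ {s | s ∈ S ∧ idx s < k + 1} :=
      fun s hs => ⟨hs.1, hs.2.trans (Nat.lt_succ_self k)⟩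
    rw [hA.ser_parabolic cs hL hwt hsub, ih (by omega), Finset.prod_range_succ, mul_comm]
    congr 1
    rw [hA.ser_orbit cs hL hsub (Finset.range (k + 1) ×ˢ (Finset.univ : Finset Bool))
      (fun x s => orbitB (idx s) x) (fun s x => moveB (idx s) x)
      (fun x => if x.2 then q * (k - x.1) else q * k + p + q * x.1) (x₀ := (k, true))]
    · exact sum_range_prod_bool k p q
    · simp
    · rintro s ⟨-, hs⟩ ⟨i, e⟩ hx
      simp only [Finset.mem_product, Finset.mem_range, Finset.mem_univ, and_true, moveB] at hx ⊢
      grind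
    · intro s _ x _
      exact moveB_moveB _ _
    · rintro s ⟨hsS, hs⟩ x _ t ⟨htS, ht⟩
      rw [hcartan s hsS t htS (by omega) (by omega)]
      exact orbitB_moveB _ _ _
    · rintro s ⟨-, hs⟩
      simp only [orbitB, boolSign, if_true]
      grind
    · rintro s ⟨hsS, hs⟩
      simp only [orbitB, boolSign, if_true, Set.mem_ofPred_eq, hsS, true_and]
      grind
    · simp
    · rintro ⟨i, e⟩ hx hne
      simp only [Finset.mem_product, Finset.mem_range, Finset.mem_univ, and_true] at hx
      cases e
      · obtain ⟨s, hsS, hs⟩ := hsurj i (by omega)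
        refine ⟨s, ⟨hsS, by omega⟩, ?_, ?_, hwt s⟩
        · simp only [orbitB, boolSign, hs]
          grind
        · rcases Nat.eq_zero_or_pos i with rfl | hi
          · simp [moveB, hs, hp s hsS hs]
          · obtain ⟨j, rfl⟩ := Nat.exists_eq_succ_of_ne_zero hi.ne'
            simp [moveB, hs, hq s hsS (by omega) (by omega)]
            ring
      · have hik : i < k := by
          refine lt_of_le_of_ne (by omega) ?_
          rintro rfl
          exact hne rfl
        obtain ⟨s, hsS, hs⟩ := hsurj (i + 1) (by omega)
        refine ⟨s, ⟨hsS, by omega⟩, ?_, ?_, hwt s⟩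
        · simp [orbitB, boolSign, hs]
        · obtain ⟨d, rfl⟩ : ∃ d, k = i + 1 + d := ⟨k - (i + 1), by omega⟩
          simp only [moveB, hs, hq s hsS (by omega) (by omega), Nat.add_eq_zero_iff, one_ne_zero,
            and_false, if_false, if_true, Nat.left_eq_add,
            show i + 1 + d - i = d + 1 by omega, show i + 1 + d - (i + 1) = d by omega]
          ring

/-- The Poincaré series of a parabolic subgroup of type `D_k`. -/
theorem IsCartan.ser_typeD (hA : IsCartan M A) (hL : IsWeight cs wt L) (hwt : ∀ s, 0 < wt s)
    {S : Set B} {idx : B → ℕ} {n q : ℕ} (hsurj : ∀ i < n, ∃ s ∈ S, idx s = i)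
    (hcartan : ∀ s ∈ S, ∀ t ∈ S, idx s < n → idx t < n → A s t = cartanD (idx s) (idx t))
    (hq : ∀ s ∈ S, idx s < n → wt s = q) {k : ℕ} (hk : k ≤ n) (hk2 : 2 ≤ k) :
    ser L (parabolic cs {s | s ∈ S ∧ idx s < k} : Set W) =
      ∏ i ∈ Finset.Ico 1 k, ((1 + (X ^ q) ^ i) * qInt (i + 1) (X ^ q)) := by
  induction k, hk2 using Nat.le_induction with
  -- The induction starts at D_2 = A_1 × A_1: e_1 pairs nontrivially with both of these roots, so
  -- the orbit argument has the right stabilizer only when going from D_k to D_{k+1} with k ≥ 2.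
  | base =>
    obtain ⟨s₀, hs₀S, hs₀⟩ := hsurj 0 (by omega)
    obtain ⟨s₁, hs₁S, hs₁⟩ := hsurj 1 (by omega)
    have hinj : ∀ s ∈ S, ∀ t ∈ S, idx s < n → idx s = idx t → s = t := by
      intro s hs t ht hsn hst
      by_contra hne
      have h1 := hcartan s hs t ht hsn (by omega)
      rw [cartanD, if_pos hst] at h1
      rcases hA.off_diag s t hne with h | h | ⟨-, h | h⟩ <;> omega
    have hsingle : ∀ s ∈ S, idx s < n → ser L (parabolic cs {s} : Set W) = 1 + X ^ q := by
      intro s hs hsn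
      -- A single reflection is type B_1.
      have := hA.ser_typeB cs hL hwt (S := {s}) (idx := fun _ => 0) (n := 1) (p := q) (q := q)
        (by simp) (by simp [cartanB, hA.diag]) (by simp [hq s hs hsn]) (by simp) le_rfl
      simpa [qInt] using this
    have hunion : {s | s ∈ S ∧ idx s < 2} = {s₀} ∪ {s₁} := by
      ext s
      simp only [Set.mem_ofPred_eq, Set.singleton_union, Set.mem_insert_iff, Set.mem_singleton_iff]
      constructor
      · rintro ⟨hs, h2⟩
        interval_cases h : idx s
        · exact Or.inl (hinj s hs s₀ hs₀S (by omega) (by omega))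
        · exact Or.inr (hinj s hs s₁ hs₁S (by omega) (by omega))
      · rintro (rfl | rfl)
        · exact ⟨hs₀S, by omega⟩
        · exact ⟨hs₁S, by omega⟩
    rw [hunion, hA.ser_parabolic_union cs hL hwt, hsingle s₀ hs₀S (by omega),
      hsingle s₁ hs₁S (by omega)]
    · simp [qInt, Finset.sum_range_succ]
    · rintro s rfl t rfl
      rw [hcartan _ hs₀S _ hs₁S (by omega) (by omega), hs₀, hs₁]
      rfl
  | succ k hk2 ih =>
    have hsub : {s | s ∈ S ∧ idx s < k} ⊆ {s | s ∈ S ∧ idx s < k + 1} :=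
      fun s hs => ⟨hs.1, hs.2.trans (Nat.lt_succ_self k)⟩
    rw [hA.ser_parabolic cs hL hwt hsub, ih (by omega), Finset.prod_Ico_succ_top (by omega),
      mul_comm]
    congr 1
    rw [hA.ser_orbit cs hL hsub (Finset.range (k + 1) ×ˢ (Finset.univ : Finset Bool))
      (fun x s => orbitD (idx s) x) (fun s x => moveD (idx s) x)
      (fun x => if x.2 then q * (k - x.1) else q * k + 0 + q * x.1) (x₀ := (k, true))]
    · rw [sum_range_prod_bool, pow_zero, one_mul]
    · simp
    · rintro s ⟨-, hs⟩ ⟨i, e⟩ hx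
      simp only [Finset.mem_product, Finset.mem_range, Finset.mem_univ, and_true, moveD] at hx ⊢
      grind
    · intro s _ x _
      exact moveD_moveD _ _
    · rintro s ⟨hsS, hs⟩ x _ t ⟨htS, ht⟩
      rw [hcartan s hsS t htS (by omega) (by omega)]
      exact orbitD_moveD _ _ _
    · rintro s ⟨-, hs⟩
      simp only [orbitD, boolSign, if_true]
      grind
    · rintro s ⟨hsS, hs⟩
      simp only [orbitD, boolSign, if_true, Set.mem_ofPred_eq, hsS, true_and]
      grind
    · simp
    · rintro ⟨i, e⟩ hx hne
      simp only [Finset.mem_product, Finset.mem_range, Finset.mem_univ, and_true] at hx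
      cases e
      · obtain ⟨s, hsS, hs⟩ := hsurj i (by omega)
        refine ⟨s, ⟨hsS, by omega⟩, ?_, ?_, hwt s⟩
        · simp only [orbitD, boolSign, hs]
          grind
        · rw [hq s hsS (by omega)]
          rcases Nat.eq_zero_or_pos i with rfl | hi
          · obtain ⟨d, rfl⟩ : ∃ d, k = d + 1 := ⟨k - 1, by omega⟩
            simp [moveD, hs]
            ring
          · obtain ⟨j, rfl⟩ := Nat.exists_eq_succ_of_ne_zero hi.ne'
            simp [moveD, hs]
            ring
      · have hik : i < k := by
          refine lt_of_le_of_ne (by omega) ?_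
          rintro rfl
          exact hne rfl
        obtain ⟨s, hsS, hs⟩ := hsurj (i + 1) (by omega)
        refine ⟨s, ⟨hsS, by omega⟩, ?_, ?_, hwt s⟩
        · simp [orbitD, boolSign, hs]
        · obtain ⟨d, rfl⟩ : ∃ d, k = i + 1 + d := ⟨k - (i + 1), by omega⟩
          simp only [moveD, hs, hq s hsS (by omega), Nat.add_eq_zero_iff, one_ne_zero,
            and_false, if_false, if_true, Nat.left_eq_add,
            show i + 1 + d - i = d + 1 by omega, show i + 1 + d - (i + 1) = d by omega]
          ring

end Chains

/-! ### q-binomial coefficients and a q-Chu–Vandermonde identity -/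

section QIdentity

variable {R : Type*} [CommRing R]

/-- The `q`-binomial coefficient at `b`. -/
def qBinom (b : R) : ℕ → ℕ → R
  | _, 0 => 1
  | 0, _ + 1 => 0
  | n + 1, m + 1 => b ^ (m + 1) * qBinom b n (m + 1) + qBinom b n m

theorem qBinom_zero_right (b : R) (n : ℕ) : qBinom b n 0 = 1 := by
  cases n <;> rfl

theorem qBinom_succ_succ (b : R) (n m : ℕ) :
    qBinom b (n + 1) (m + 1) = b ^ (m + 1) * qBinom b n (m + 1) + qBinom b n m := rfl

theorem qBinom_eq_zero (b : R) {n m : ℕ} (h : n < m) : qBinom b n m = 0 := by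
  induction n generalizing m with
  | zero =>
    obtain ⟨m, rfl⟩ := Nat.exists_eq_succ_of_ne_zero h.ne'
    rfl
  | succ n ih =>
    obtain ⟨m, rfl⟩ := Nat.exists_eq_succ_of_ne_zero (by omega : m ≠ 0)
    rw [Nat.succ_eq_add_one, qBinom_succ_succ, ih (by omega), ih (by omega)]
    simp

/-- The `q`-factorial at `b`. -/
def qFact (b : R) (k : ℕ) : R := ∏ i ∈ Finset.range k, qInt (i + 1) b

theorem qFact_succ (b : R) (k : ℕ) : qFact b (k + 1) = qFact b k * qInt (k + 1) b :=
  Finset.prod_range_succ _ _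

theorem qInt_add (b : R) (m d : ℕ) : qInt (m + d) b = qInt m b + b ^ m * qInt d b := by
  simp only [qInt, Finset.sum_range_add, Finset.mul_sum, pow_add]

theorem qBinom_mul_qFact (b : R) (m d : ℕ) :
    qBinom b (m + d) m * (qFact b m * qFact b d) = qFact b (m + d) := by
  induction h : m + d generalizing m d with
  | zero =>
    obtain ⟨rfl, rfl⟩ : m = 0 ∧ d = 0 := by omega
    simp [qBinom, qFact]
  | succ n ih =>
    rcases m with _ | m
    · rw [qBinom_zero_right, ← h, zero_add]
      simp [qFact]
    rw [qBinom_succ_succ]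
    rcases d with _ | d
    · obtain rfl : n = m := by omega
      have := ih n 0 (by omega)
      rw [qBinom_eq_zero b (Nat.lt_succ_self n), qFact_succ]
      linear_combination (qInt (n + 1) b) * this
    · have h1 := ih (m + 1) d (by omega)
      have h2 := ih m (d + 1) (by omega)
      have h3 : qInt (n + 1) b = qInt (m + 1) b + b ^ (m + 1) * qInt (d + 1) b := by
        rw [← qInt_add]; congr 1; omega
      rw [qFact_succ b n, h3]
      rw [qFact_succ] at h1 h2 ⊢
      rw [qFact_succ b d]
      linear_combination (b ^ (m + 1) * qInt (d + 1) b) * h1 + qInt (m + 1) b * h2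

/-- A form of the `q`-Chu–Vandermonde identity. -/
theorem sum_qBinom_mul_prod (b : R) (n : ℕ) (a c : R) :
    ∑ m ∈ Finset.range (n + 1), (-1) ^ m * qBinom b n m * c ^ m * b ^ (m * (m - 1)) *
      ((∏ i ∈ Finset.Ico (n - m) n, (1 + a * b ^ i)) * ∏ i ∈ Finset.Ico m n, (1 + c * b ^ i)) =
    ∏ i ∈ Finset.range n, (1 - a * c * b ^ (n - 1 + i)) := by
  induction n generalizing a c with
  | zero => simp [qBinom]
  | succ n ih =>
    have hU : ∀ m ≤ n, ∏ i ∈ Finset.Ico (n + 1 - m) (n + 1), (1 + a * b ^ i) =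
        ∏ i ∈ Finset.Ico (n - m) n, (1 + a * b * b ^ i) := by
      intro m hm
      rw [show n + 1 - m = n - m + 1 by omega, ← Finset.prod_Ico_add' _ (n - m) n 1]
      exact Finset.prod_congr rfl fun i _ => by ring
    have hV : ∀ m, ∏ i ∈ Finset.Ico (m + 1) (n + 1), (1 + c * b ^ i) =
        ∏ i ∈ Finset.Ico m n, (1 + c * b * b ^ i) := by
      intro m
      rw [← Finset.prod_Ico_add' _ m n 1]
      exact Finset.prod_congr rfl fun i _ => by ring
    have hU' : ∀ m ≤ n, ∏ i ∈ Finset.Ico (n + 1 - (m + 1)) (n + 1), (1 + a * b ^ i) =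
        (1 + a * b ^ (n - m)) * ∏ i ∈ Finset.Ico (n - m) n, (1 + a * b * b ^ i) := by
      intro m hm
      rw [Nat.add_sub_add_right, Finset.prod_eq_prod_Ico_succ_bot (by omega), ← hU m hm]
      congr 3
      omega
    have hV' : ∀ m ≤ n, ∏ i ∈ Finset.Ico m (n + 1), (1 + c * b ^ i) =
        (1 + c * b ^ m) * ∏ i ∈ Finset.Ico m n, (1 + c * b * b ^ i) := by
      intro m hm
      rw [Finset.prod_eq_prod_Ico_succ_bot (by omega), hV]
    -- T is the summand for n at (a b, c b), and P is the first Pascal part of the summand for n +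
    -- 1. The second Pascal part, shifted by one, is also a multiple of T, and the two together
    -- leave the factor 1 - a c b^n.
    let T : ℕ → R := fun m => (-1) ^ m * qBinom b n m * (c * b) ^ m * b ^ (m * (m - 1)) *
      ((∏ i ∈ Finset.Ico (n - m) n, (1 + a * b * b ^ i)) *
        ∏ i ∈ Finset.Ico m n, (1 + c * b * b ^ i))
    let P : ℕ → R := fun m => (-1) ^ m * (b ^ m * qBinom b n m) * c ^ m * b ^ (m * (m - 1)) *
      ((∏ i ∈ Finset.Ico (n + 1 - m) (n + 1), (1 + a * b ^ i)) *
        ∏ i ∈ Finset.Ico m (n + 1), (1 + c * b ^ i))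
    have hP : ∀ m ≤ n, P m = T m * (1 + c * b ^ m) := by
      intro m hm
      simp only [P, T, hU m hm, hV' m hm]
      ring
    have hstep : ∀ m ≤ n, (-1) ^ (m + 1) * qBinom b (n + 1) (m + 1) * c ^ (m + 1) *
        b ^ ((m + 1) * (m + 1 - 1)) *
        ((∏ i ∈ Finset.Ico (n + 1 - (m + 1)) (n + 1), (1 + a * b ^ i)) *
          ∏ i ∈ Finset.Ico (m + 1) (n + 1), (1 + c * b ^ i)) =
        P (m + 1) - T m * (c * b ^ m * (1 + a * b ^ (n - m))) := by
      intro m hm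
      have hb : b ^ ((m + 1) * (m + 1 - 1)) = b ^ m * b ^ (m * (m - 1)) * b ^ m := by
        rw [← pow_add, ← pow_add]
        congr 1
        rcases m with _ | m
        · simp
        · simp; ring
      simp only [P, T, qBinom_succ_succ, hU' m hm, hV m]
      rw [hb]
      ring
    rw [Finset.sum_range_succ', Finset.sum_congr rfl fun m hm =>
      hstep m (by rw [Finset.mem_range] at hm; omega), Finset.sum_sub_distrib]
    have h0 : (-1) ^ 0 * qBinom b (n + 1) 0 * c ^ 0 * b ^ (0 * (0 - 1)) *
        ((∏ i ∈ Finset.Ico (n + 1 - 0) (n + 1), (1 + a * b ^ i)) *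
          ∏ i ∈ Finset.Ico 0 (n + 1), (1 + c * b ^ i)) = P 0 := by
      simp [P, qBinom_zero_right]
    have hlast : P (n + 1) = 0 := by
      simp [P, qBinom_eq_zero b (Nat.lt_succ_self n)]
    rw [h0, sub_add_eq_add_sub, ← Finset.sum_range_succ', Finset.sum_range_succ, hlast, add_zero,
      ← Finset.sum_sub_distrib]
    have hT : ∀ m ∈ Finset.range (n + 1), P m - T m * (c * b ^ m * (1 + a * b ^ (n - m))) =
        (1 - a * c * b ^ n) * T m := by
      intro m hm
      rw [Finset.mem_range] at hm
      rw [hP m (by omega)]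
      have : b ^ n = b ^ m * b ^ (n - m) := by rw [← pow_add]; congr 1; omega
      rw [this]
      ring
    rw [Finset.sum_congr rfl hT, ← Finset.mul_sum, ih (a * b) (c * b), Finset.prod_range_succ']
    rw [mul_comm]
    congr 1
    refine Finset.prod_congr rfl fun i hi => ?_
    rw [Finset.mem_range] at hi
    rw [show n + 1 - 1 + (i + 1) = n - 1 + i + 2 by omega]
    ring

end QIdentity

/-! ### The affine Cartan matrix of type B̃ and its null root -/

section AffineB

/-- A Cartan matrix of the Coxeter matrix `affineB n`. -/
def cartanAffineB (n : ℕ) (i j : Fin (n + 1)) : ℤ :=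
  if i = j then 2 else if (i : ℕ) = 1 ∧ (j : ℕ) = 0 then -2 else
    if ((i : ℕ) = 0 ∧ (j : ℕ) = 1) ∨ EdgeB n i j ∨ EdgeB n j i then -1 else 0

theorem isCartan_affineB (n : ℕ) : IsCartan (affineB n) (cartanAffineB n) where
  diag i := by simp [cartanAffineB]
  off_diag i j hij := by
    have hij' : (i : ℕ) ≠ j := fun h => hij (Fin.ext h)
    have hM : (affineB n).M i j =
      if ((i : ℕ) = 0 ∧ (j : ℕ) = 1) ∨ ((j : ℕ) = 0 ∧ (i : ℕ) = 1) then 4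
      else if EdgeB n i j ∨ EdgeB n j i then 3 else 2 := by
      simp [affineB, hij]
    rw [hM]
    simp only [cartanAffineB, hij, hij.symm, if_false]
    by_cases h1 : (i : ℕ) = 1 ∧ (j : ℕ) = 0
    · have h2 : ¬((j : ℕ) = 1 ∧ (i : ℕ) = 0) := by omega
      simp [h1]
    · by_cases h2 : (j : ℕ) = 1 ∧ (i : ℕ) = 0
      · simp [h2]
      · rw [if_neg h1, if_neg h2,
          if_neg (show ¬(((i : ℕ) = 0 ∧ (j : ℕ) = 1) ∨ ((j : ℕ) = 0 ∧ (i : ℕ) = 1)) by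
            rintro (h | h); exacts [h2 h.symm, h1 h.symm])]
        by_cases hE : EdgeB n i j ∨ EdgeB n j i
        · rw [if_pos hE, if_pos (Or.inr hE), if_pos (Or.inr hE.symm)]
          simp
        · rw [if_neg hE, if_neg (by rintro (h | h); exacts [h2 h.symm, hE h]),
            if_neg (by rintro (h | h); exacts [h1 h.symm, hE h.symm])]
          simp

/-- The coefficients of the null root of type `B̃_n`. -/
def nullRoot (n : ℕ) (i : Fin (n + 1)) : ℤ :=
  if (i : ℕ) = 0 then 1 else if (i : ℕ) + 2 ≤ n then 2 else 1

theorem pairing_nullRoot {n : ℕ} (hn : 3 ≤ n) (s : Fin (n + 1)) :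
    pairing (cartanAffineB n) s (nullRoot n) = 0 := by
  rw [pairing_apply]
  have hs := s.2
  let δ : ℕ → ℤ := fun i => if i = 0 then 1 else if i + 2 ≤ n then 2 else 1
  -- The row sum is written as a sum of point masses, at s itself, at s - 1 and s + 1 along the
  -- path, and at n and n - 2 for the fork edge; each case is then a small computation.
  let F : ℕ → ℤ := fun j => (if (s : ℕ) = j then 2 * δ s else 0) +
    (if (s : ℕ) - 1 = j then
      (if (s : ℕ) = 0 ∨ (s : ℕ) = n then 0 else if (s : ℕ) = 1 then -2 else -δ (s - 1)) else 0) +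
    (if (s : ℕ) + 1 = j then (if (s : ℕ) + 1 < n then -δ (s + 1) else 0) else 0) +
    (if n = j then (if (s : ℕ) + 2 = n then -1 else 0) else 0) +
    (if n - 2 = j then (if (s : ℕ) = n then -δ (n - 2) else 0) else 0)
  have h : ∀ j : Fin (n + 1), cartanAffineB n s j * nullRoot n j = F j := by
    intro j
    have := j.2
    simp only [cartanAffineB, nullRoot, Fin.ext_iff, EdgeB, δ, F]
    generalize (s : ℕ) = x at *
    generalize (j : ℕ) = y at *
    by_cases h1 : x = y
    · subst h1
      grind (splits := 30)
    by_cases h2 : x - 1 = y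
    · grind (splits := 30)
    by_cases h3 : x + 1 = y
    · grind (splits := 30)
    by_cases h4 : x = n
    · grind (splits := 30)
    · grind (splits := 30)
  rw [Finset.sum_congr rfl fun j _ => h j, Fin.sum_univ_eq_sum_range F]
  simp only [F, Finset.sum_add_distrib, Finset.sum_ite_eq, Finset.mem_range, δ]
  generalize (s : ℕ) = x at *
  by_cases h0 : x = 0
  · subst h0
    simp; grind
  by_cases h1 : x = 1
  · subst h1
    simp; grind
  by_cases h2 : x = n
  · grind
  · grind

/-- No element of the affine group has only descents. -/
theorem descOn_univ_affineB {n : ℕ} (hn : 3 ≤ n) {W : Type*} [Group W]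
    (cs : CoxeterSystem (affineB n) W) : descOn cs Set.univ = ∅ := by
  have hA := isCartan_affineB n
  refine Set.eq_empty_of_forall_notMem fun w hw => ?_
  have hfix : hA.rep cs w (nullRoot n) = nullRoot n := by
    clear hw
    induction w using cs.simple_induction_left with
    | one => simp
    | mul_simple_left w s ih =>
      rw [hA.rep_mul_apply, ih, hA.rep_simple, rootReflection_apply, pairing_nullRoot hn]
      simp
  -- An element with only descents would send the positive null root to a nonpositive vector,
  -- although it fixes it.
  have h1 := hA.rep_nonpos_of_descOn cs hw (x := nullRoot n)
    (fun i => by simp only [nullRoot, Pi.zero_apply]; split_ifs <;> simp) (by simp)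
  rw [hfix] at h1
  have := h1 0
  simp [nullRoot] at this

end AffineB

/-! ### Degrees of Poincaré polynomials -/

section Degree

/-- `f` is a monic polynomial of degree `N`. -/
def IsMonicOfDegree (f : ℚ⟦X⟧) (N : ℕ) : Prop :=
  ∃ p : Polynomial ℚ, p.Monic ∧ p.natDegree = N ∧ f = p

theorem IsMonicOfDegree.mul {f g : ℚ⟦X⟧} {N K : ℕ} (hf : IsMonicOfDegree f N)
    (hg : IsMonicOfDegree g K) : IsMonicOfDegree (f * g) (N + K) := by
  obtain ⟨p, hp, rfl, rfl⟩ := hf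
  obtain ⟨r, hr, rfl, rfl⟩ := hg
  exact ⟨p * r, hp.mul hr, hp.natDegree_mul hr, by simp⟩

theorem IsMonicOfDegree.coeff_ne_zero {f : ℚ⟦X⟧} {N : ℕ} (hf : IsMonicOfDegree f N) :
    coeff N f ≠ 0 := by
  obtain ⟨p, hp, rfl, rfl⟩ := hf
  rw [Polynomial.coeff_coe, hp.coeff_natDegree]
  exact one_ne_zero

theorem IsMonicOfDegree.coeff_eq_zero {f : ℚ⟦X⟧} {N : ℕ} (hf : IsMonicOfDegree f N) {k : ℕ}
    (hk : N < k) : coeff k f = 0 := by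
  obtain ⟨p, hp, rfl, rfl⟩ := hf
  rw [Polynomial.coeff_coe, Polynomial.coeff_eq_zero_of_natDegree_lt hk]

theorem isMonicOfDegree_add_X_pow {f : ℚ⟦X⟧} {N K : ℕ} (hf : IsMonicOfDegree f N) (h : N < K) :
    IsMonicOfDegree (f + X ^ K) K := by
  obtain ⟨p, hp, rfl, rfl⟩ := hf
  have hd : p.degree < (Polynomial.X ^ K : Polynomial ℚ).degree := by
    rw [Polynomial.degree_X_pow, Polynomial.degree_eq_natDegree hp.ne_zero]
    exact_mod_cast h
  refine ⟨p + Polynomial.X ^ K, (Polynomial.monic_X_pow K).add_of_right hd, ?_, by simp⟩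
  rw [Polynomial.natDegree_add_eq_right_of_degree_lt hd, Polynomial.natDegree_X_pow]

theorem isMonicOfDegree_one : IsMonicOfDegree 1 0 :=
  ⟨1, Polynomial.monic_one, Polynomial.natDegree_one, by simp⟩

theorem isMonicOfDegree_qInt {q : ℕ} (hq : 0 < q) (i : ℕ) :
    IsMonicOfDegree (qInt (i + 1) (X ^ q)) (q * i) := by
  induction i with
  | zero => simpa [qInt] using isMonicOfDegree_one
  | succ i ih =>
    have : qInt (i + 1 + 1) (X ^ q : ℚ⟦X⟧) = qInt (i + 1) (X ^ q) + X ^ (q * (i + 1)) := by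
      rw [qInt, Finset.sum_range_succ, ← qInt, ← pow_mul]
    rw [this]
    exact isMonicOfDegree_add_X_pow ih (Nat.mul_lt_mul_of_pos_left (Nat.lt_succ_self i) hq)

theorem isMonicOfDegree_typeD {q : ℕ} (hq : 0 < q) (k : ℕ) :
    IsMonicOfDegree (∏ i ∈ Finset.Ico 1 (k + 1), ((1 + (X ^ q) ^ i) * qInt (i + 1) (X ^ q)))
      (q * ((k + 1) * k)) := by
  induction k with
  | zero => simpa using isMonicOfDegree_one
  | succ k ih =>
    rw [Finset.prod_Ico_succ_top (by omega)]
    have h1 : IsMonicOfDegree (1 + (X ^ q) ^ (k + 1)) (q * (k + 1)) := by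
      rw [← pow_mul]
      exact isMonicOfDegree_add_X_pow isMonicOfDegree_one (by positivity)
    have := ih.mul (h1.mul (isMonicOfDegree_qInt hq (k + 1)))
    rwa [show q * ((k + 1) * k) + (q * (k + 1) + q * (k + 1)) = q * ((k + 1 + 1) * (k + 1)) by
      ring] at this

end Degree

/-! ### The weighted Poincaré series of type B̃ -/

section AffineSeries

theorem ser_ne_zero {α : Type*} {L : α → ℕ} (hfin : ∀ k, {x | L x = k}.Finite) {S : Set α} {x : α}
    (hx : x ∈ S) : ser L S ≠ 0 := by
  intro h
  have h1 := coeff_ser L S (L x)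
  rw [h, map_zero, eq_comm, Nat.cast_eq_zero,
    Set.ncard_eq_zero ((hfin (L x)).subset fun y hy => hy.2)] at h1
  exact Set.notMem_empty x (h1 ▸ ⟨hx, rfl⟩)

theorem sum_telescope {R : Type*} [CommRing R] (Q : ℕ → R) (n N : ℕ) (hN : N ≤ n) :
    ∑ m ∈ Finset.range (N + 1), (-1) ^ m * (Q (n - m) + Q (n - m + 1)) =
      Q (n + 1) + (-1) ^ N * Q (n - N) := by
  induction N with
  | zero => simp [add_comm]
  | succ N ih =>
    rw [Finset.sum_range_succ, ih (by omega), show n - (N + 1) + 1 = n - N by omega]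
    ring

/-- The alternating sum over the elements ascending below `k` and descending above `k`. -/
theorem sum_ser_ascOn_inter_descOn {n : ℕ} (hn : 3 ≤ n) {W : Type*} [Group W]
    (cs : CoxeterSystem (affineB n) W) {L : W → ℕ} (h1 : L 1 = 0)
    (hfin : ∀ k, {x | L x = k}.Finite) :
    ∑ m ∈ Finset.range (n + 1), (-1) ^ m *
      ser L (ascOn cs {s | (s : ℕ) < n - m} ∩ descOn cs {s | n - m < (s : ℕ)}) = 1 := by
  -- Q k counts the elements whose descents are exactly the vertices from k on. Leaving vertex k
  -- free gives Q k + Q (k + 1), which makes the alternating sum telescope.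
  let Q : ℕ → ℚ⟦X⟧ := fun k => ser L (ascOn cs {s | (s : ℕ) < k} ∩ descOn cs {s | k ≤ (s : ℕ)})
  have hQ : ∀ k ≤ n, ser L (ascOn cs {s | (s : ℕ) < k} ∩ descOn cs {s | k < (s : ℕ)}) =
      Q k + Q (k + 1) := by
    intro k hk
    rw [← ser_union hfin]
    · congr 1
      ext w
      constructor
      · rintro ⟨ha, hd⟩
        rcases cs.length_mul_simple w ⟨k, by omega⟩ with h | h
        · refine Or.inr ⟨fun s hs => ?_, fun s hs => hd s hs⟩
          rcases Nat.lt_succ_iff_lt_or_eq.1 hs with h' | h'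
          · exact ha s h'
          · rwa [show s = ⟨k, by omega⟩ from Fin.ext h']
        · refine Or.inl ⟨ha, fun s hs => ?_⟩
          rcases lt_or_eq_of_le (show k ≤ (s : ℕ) from hs) with h' | h'
          · exact hd s h'
          · rwa [show s = ⟨k, by omega⟩ from Fin.ext h'.symm]
      · rintro (⟨ha, hd⟩ | ⟨ha, hd⟩)
        · exact ⟨ha, fun s hs => hd s (Nat.le_of_lt hs)⟩
        · exact ⟨fun s hs => ha s (Nat.lt_succ_of_lt hs), hd⟩
    · rw [Set.disjoint_left]
      rintro w ⟨-, hd⟩ ⟨ha, -⟩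
      have h1 := hd ⟨k, by omega⟩ (le_refl k)
      have h2 := ha ⟨k, by omega⟩ (Nat.lt_succ_self k)
      omega
  rw [Finset.sum_congr rfl fun m hm => by rw [hQ (n - m) (by omega)], sum_telescope Q n n le_rfl]
  have h0 : Q (n - n) = 0 := by
    have : {s : Fin (n + 1) | n - n ≤ (s : ℕ)} = Set.univ := by ext; simp
    simp only [Q]
    rw [this, descOn_univ_affineB hn, Set.inter_empty, ser_empty]
  have h2 : Q (n + 1) = 1 := by
    have : ascOn cs {s : Fin (n + 1) | (s : ℕ) < n + 1} ∩ descOn cs {s | n + 1 ≤ (s : ℕ)} = {1} := by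
      ext w
      constructor
      · rintro ⟨ha, -⟩
        by_contra hw
        obtain ⟨s, hs⟩ := cs.exists_rightDescent_of_ne_one hw
        rw [cs.isRightDescent_iff] at hs
        have := ha s s.2
        omega
      · rintro rfl
        exact ⟨fun s _ => by simp, fun s hs => by have := s.2; simp at hs; omega⟩
    simp only [Q]
    rw [this, ser_singleton, h1, pow_zero]
  rw [h0, h2]
  simp

section

variable (a b : ℚ⟦X⟧)

theorem prod_typeB_eq (k : ℕ) :
    ∏ i ∈ Finset.range k, ((1 + a * b ^ i) * qInt (i + 1) b) =
      (∏ i ∈ Finset.range k, (1 + a * b ^ i)) * qFact b k := by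
  rw [Finset.prod_mul_distrib, qFact]

theorem prod_typeD_eq {k : ℕ} (hk : 1 ≤ k) :
    ∏ i ∈ Finset.Ico 1 k, ((1 + b ^ i) * qInt (i + 1) b) =
      (∏ i ∈ Finset.Ico 1 k, (1 + b ^ i)) * qFact b k := by
  have h : qFact b k = ∏ i ∈ Finset.Ico 1 k, qInt (i + 1) b := by
    rw [qFact, Finset.range_eq_Ico, Finset.prod_eq_prod_Ico_succ_bot (show 0 < k by omega)]
    simp [qInt]
  rw [Finset.prod_mul_distrib, h]

/-- This clears denominators: the summand of the q-identity is a common numerator divided by the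
series of B_{n-m} and D_m. The q-factorials cancel through the q-binomial coefficient. -/
theorem qBinom_mul_typeB_mul_typeD {n m : ℕ} (hm : 1 ≤ m) (hmn : m ≤ n) :
    qBinom b n m * ((∏ i ∈ Finset.Ico (n - m) n, (1 + a * b ^ i)) *
      ∏ i ∈ Finset.Ico m n, (1 + 1 * b ^ i)) *
      ((∏ i ∈ Finset.range (n - m), ((1 + a * b ^ i) * qInt (i + 1) b)) *
        ∏ i ∈ Finset.Ico 1 m, ((1 + b ^ i) * qInt (i + 1) b)) =
    (∏ i ∈ Finset.range n, ((1 + a * b ^ i) * qInt (i + 1) b)) *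
      ∏ i ∈ Finset.Ico 1 n, (1 + b ^ i) := by
  rw [prod_typeB_eq, prod_typeB_eq, prod_typeD_eq b hm,
    ← Finset.prod_range_mul_prod_Ico _ (Nat.sub_le n m),
    ← Finset.prod_Ico_consecutive _ hm hmn]
  have := qBinom_mul_qFact b m (n - m)
  rw [Nat.add_sub_cancel' hmn] at this
  rw [← this]
  simp only [one_mul]
  ring

end

/-- The weighted Poincaré series of the affine Coxeter group of type `B̃_n`. -/
theorem ser_affineB {n : ℕ} (hn : 3 ≤ n) {W : Type*} [Group W] (cs : CoxeterSystem (affineB n) W)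
    {wt : Fin (n + 1) → ℕ} {L : W → ℕ} (hL : IsWeight cs wt L) {p q : ℕ} (hp : 0 < p) (hq : 0 < q)
    (hwt : ∀ s, wt s = if (s : ℕ) = 0 then p else q) :
    ser L Set.univ * ∏ i ∈ Finset.range n, (1 - X ^ p * (X ^ q) ^ (n - 1 + i)) =
      (∏ i ∈ Finset.range n, ((1 + X ^ p * (X ^ q) ^ i) * qInt (i + 1) (X ^ q))) *
        ∏ i ∈ Finset.Ico 1 n, (1 + (X ^ q) ^ i) := by
  have hA := isCartan_affineB n
  have hpos : ∀ s, 0 < wt s := fun s => by rw [hwt]; split_ifs <;> assumption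
  have hfin := hL.finite_fibre hpos
  set a : ℚ⟦X⟧ := X ^ p with ha
  set b : ℚ⟦X⟧ := X ^ q with hb
  set Bk : ℕ → ℚ⟦X⟧ := fun k => ∏ i ∈ Finset.range k, ((1 + a * b ^ i) * qInt (i + 1) b) with hBk
  set Dk : ℕ → ℚ⟦X⟧ := fun k => ∏ i ∈ Finset.Ico 1 k, ((1 + b ^ i) * qInt (i + 1) b) with hDk
  have hcart : ∀ s t : Fin (n + 1), (s : ℕ) < n → (t : ℕ) < n →
      cartanAffineB n s t = cartanB s t := by
    intro s t hs ht
    simp only [cartanAffineB, cartanB, EdgeB, Fin.ext_iff]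
    grind
  have hserB : ∀ k ≤ n, ser L (parabolic cs {s | (s : ℕ) < k} : Set W) = Bk k := by
    intro k hk
    have := hA.ser_typeB cs hL hpos (S := Set.univ) (idx := fun s => (s : ℕ)) (n := n) (p := p)
      (q := q) (fun i hi => ⟨⟨i, by omega⟩, trivial, rfl⟩) (fun s _ t _ => hcart s t)
      (fun s _ h => by simp [hwt, h]) (fun s _ _ h => by simp [hwt, h]) hk
    simpa using this
  -- The two prongs of the fork are interchangeable: omitting n - 1 instead of n again leaves type
  -- B_n, with n playing the role of n - 1.
  have hserB' : ser L (parabolic cs ({s | (s : ℕ) < n - 1} ∪ {s | n - 1 < (s : ℕ)}) : Set W) =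
      Bk n := by
    have := hA.ser_typeB cs hL hpos (S := {s | (s : ℕ) ≠ n - 1})
      (idx := fun s => if (s : ℕ) = n then n - 1 else s) (n := n) (p := p) (q := q)
      (fun i hi => by
        by_cases h : i = n - 1
        · exact ⟨⟨n, by omega⟩, by simp; omega, by simp [h]⟩
        · exact ⟨⟨i, by omega⟩, by simpa using h, by simp; omega⟩)
      (fun s hs t ht _ _ => by
        have := s.2
        have := t.2
        simp only [Set.mem_ofPred_eq] at hs ht
        simp only [cartanAffineB, cartanB, EdgeB, Fin.ext_iff]
        generalize (s : ℕ) = x at *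
        generalize (t : ℕ) = y at *
        by_cases hx : x = n <;> by_cases hy : y = n
        · simp [hx, hy]
        · grind (splits := 30)
        · grind (splits := 30)
        · grind (splits := 30))
      (fun s _ h => by rw [hwt]; split_ifs at h ⊢ <;> omega)
      (fun s _ _ h => by rw [hwt]; split_ifs at h ⊢ <;> omega) (k := n) le_rfl
    refine Eq.trans ?_ this
    congr 3
    ext s
    have := s.2
    simp only [Set.mem_union, Set.mem_ofPred_eq]
    split_ifs <;> omega
  have hserD : ∀ m, 2 ≤ m → m ≤ n →
      ser L (parabolic cs {s | n - m < (s : ℕ)} : Set W) = Dk m := by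
    intro m hm hmn
    have := hA.ser_typeD cs hL hpos (S := Set.univ) (idx := fun s => n - (s : ℕ)) (n := n)
      (q := q) (fun i hi => ⟨⟨n - i, by omega⟩, trivial, by simp; omega⟩)
      (fun s _ t _ hs ht => by
        have := s.2
        have := t.2
        simp only [cartanAffineB, cartanD, EdgeB, Fin.ext_iff]
        generalize (s : ℕ) = x at *
        generalize (t : ℕ) = y at *
        by_cases h1 : x = y
        · simp [h1]
        · grind (splits := 30))
      (fun s _ h => by rw [hwt, if_neg (by omega)]) hmn hm
    refine Eq.trans ?_ this
    congr 3
    ext s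
    have := s.2
    simp only [Set.mem_univ, true_and, Set.mem_ofPred_eq]
    omega
  have hasc : ∀ k ≤ n, ser L (ascOn cs {s | (s : ℕ) < k}) * Bk k = ser L Set.univ := by
    intro k hk
    rw [hA.ser_univ cs hL hpos {s | (s : ℕ) < k}, hserB k hk]
  have hBne : Bk n ≠ 0 := by
    rw [← hserB n le_rfl]
    exact ser_ne_zero hfin (one_mem _)
  have hasc' : ser L (ascOn cs ({s | (s : ℕ) < n - 1} ∪ {s | n - 1 < (s : ℕ)})) =
      ser L (ascOn cs {s | (s : ℕ) < n}) := by
    refine mul_right_cancel₀ hBne ?_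
    rw [hasc n le_rfl, ← hserB', ← hA.ser_univ cs hL hpos]
  have hmid : ∀ m, 2 ≤ m → m ≤ n →
      ser L (ascOn cs {s | (s : ℕ) < n - m} ∩ descOn cs {s | n - m < (s : ℕ)}) *
        (Bk (n - m) * Dk m) = ser L Set.univ * b ^ (m * (m - 1)) := by
    intro m hm hmn
    have horth : ∀ s ∈ {s : Fin (n + 1) | n - m < (s : ℕ)},
        ∀ t ∈ {t : Fin (n + 1) | (t : ℕ) < n - m},
        cartanAffineB n s t = 0 ∧ cartanAffineB n t s = 0 := by
      intro s hs t ht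
      simp only [Set.mem_ofPred_eq] at hs ht
      have := s.2
      have := t.2
      simp only [cartanAffineB, EdgeB, Fin.ext_iff]
      constructor <;> repeat rw [if_neg (by omega)]
    -- The degree of the series of D_m is the weight of its longest element, the source of
    -- b^{m(m-1)}.
    have hdeg : IsMonicOfDegree (Dk m) (q * (m * (m - 1))) := by
      obtain ⟨k, rfl⟩ : ∃ k, m = k + 1 := ⟨m - 1, by omega⟩
      exact isMonicOfDegree_typeD hq k
    rw [← hserD m hm hmn] at hdeg
    obtain ⟨w₀, hw₀, hw₀K, hLw⟩ := hL.exists_longest cs hpos hdeg.coeff_ne_zero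
      fun k hk => hdeg.coeff_eq_zero hk
    rw [hA.ser_ascOn_inter_descOn cs hL hpos (fun s hs t ht => (horth s hs t ht).1) hw₀ hw₀K, hLw,
      hA.ser_univ cs hL hpos ({s | (s : ℕ) < n - m} ∪ {s | n - m < (s : ℕ)}),
      hA.ser_parabolic_union cs hL hpos (fun s hs t ht => (horth t ht s hs).2),
      hserB _ (Nat.sub_le n m), hserD m hm hmn, hb, ← pow_mul]
    ring
  have htel := sum_ser_ascOn_inter_descOn hn cs hL.one hfin
  have hqid := sum_qBinom_mul_prod b n a 1
  set C := Bk n * ∏ i ∈ Finset.Ico 1 n, (1 + b ^ i) with hC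
  obtain ⟨N, rfl⟩ : ∃ N, n = N + 1 := ⟨n - 1, by omega⟩
  -- The terms m = 0, 1 are split off, since the vertices above n - m form a subdiagram of type D_m
  -- only for m ≥ 2.
  rw [Finset.sum_range_succ', Finset.sum_range_succ'] at hqid htel
  have hP0 : ser L (ascOn cs {s : Fin (N + 1 + 1) | (s : ℕ) < N + 1 - 0} ∩
      descOn cs {s | N + 1 - 0 < (s : ℕ)}) = ser L (ascOn cs {s | (s : ℕ) < N + 1}) := by
    congr 1
    refine Set.inter_eq_left.2 fun w _ s hs => ?_
    have := s.2
    simp only [Set.mem_ofPred_eq] at hs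
    omega
  -- For m = 1, a descent at n is the complement of an ascent at n. The subtracted set has the same
  -- series as the term m = 0, by the symmetry of the fork.
  have hP1 : ser L (ascOn cs {s : Fin (N + 1 + 1) | (s : ℕ) < N + 1 - (0 + 1)} ∩
      descOn cs {s | N + 1 - (0 + 1) < (s : ℕ)}) =
      ser L (ascOn cs {s | (s : ℕ) < N}) - ser L (ascOn cs {s | (s : ℕ) < N + 1}) := by
    rw [eq_sub_iff_add_eq, ← hasc', ← ser_union hfin]
    · congr 1
      ext w
      simp only [Set.mem_union, Set.mem_inter_iff, mem_ascOn_union, Nat.add_sub_cancel, zero_add]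
      constructor
      · rintro (h | h) <;> exact h.1
      · intro h
        rcases cs.length_mul_simple w ⟨N + 1, by omega⟩ with h' | h'
        · refine Or.inr ⟨h, fun s hs => ?_⟩
          rwa [show s = ⟨N + 1, by omega⟩ from Fin.ext (by
            have := s.2; simp only [Set.mem_ofPred_eq] at hs; simp only; omega)]
        · refine Or.inl ⟨h, fun s hs => ?_⟩
          rwa [show s = ⟨N + 1, by omega⟩ from Fin.ext (by
            have := s.2; simp only [Set.mem_ofPred_eq] at hs; simp only; omega)]
    · rw [Set.disjoint_left]
      rintro w ⟨-, hd⟩ hw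
      have h1 := hd ⟨N + 1, by omega⟩ (by simp)
      have h2 := ((mem_ascOn_union cs).1 hw).2 ⟨N + 1, by omega⟩ (by simp)
      omega
  rw [hP0, hP1] at htel
  have key : ∀ m ∈ Finset.range N, ser L Set.univ *
      ((-1) ^ (m + 1 + 1) * qBinom b (N + 1) (m + 1 + 1) * 1 ^ (m + 1 + 1) *
        b ^ ((m + 1 + 1) * (m + 1 + 1 - 1)) *
        ((∏ i ∈ Finset.Ico (N + 1 - (m + 1 + 1)) (N + 1), (1 + a * b ^ i)) *
          ∏ i ∈ Finset.Ico (m + 1 + 1) (N + 1), (1 + 1 * b ^ i))) =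
      C * ((-1) ^ (m + 1 + 1) * ser L (ascOn cs {s | (s : ℕ) < N + 1 - (m + 1 + 1)} ∩
        descOn cs {s | N + 1 - (m + 1 + 1) < (s : ℕ)})) := by
    intro m hm
    rw [Finset.mem_range] at hm
    have h1 := hmid (m + 1 + 1) (by omega) (by omega)
    have h2 := qBinom_mul_typeB_mul_typeD a b (n := N + 1) (m := m + 1 + 1) (by omega) (by omega)
    rw [hC, ← h2, one_pow]
    simp only [hBk, hDk] at h1
    linear_combination (-1) * (-1) ^ (m + 1 + 1) * qBinom b (N + 1) (m + 1 + 1) *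
      ((∏ i ∈ Finset.Ico (N + 1 - (m + 1 + 1)) (N + 1), (1 + a * b ^ i)) *
          ∏ i ∈ Finset.Ico (m + 1 + 1) (N + 1), (1 + 1 * b ^ i)) * h1
  have key1 : ser L Set.univ * (qBinom b (N + 1) 1 *
        ((∏ i ∈ Finset.Ico N (N + 1), (1 + a * b ^ i)) *
          ∏ i ∈ Finset.Ico 1 (N + 1), (1 + 1 * b ^ i))) =
      C * ser L (ascOn cs {s | (s : ℕ) < N}) := by
    have h2 := qBinom_mul_typeB_mul_typeD a b (n := N + 1) (m := 1) le_rfl (by omega)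
    rw [hC, ← h2, ← hasc N (by omega)]
    simp only [hBk, Nat.add_sub_cancel, Finset.Ico_self, Finset.prod_empty]
    ring
  -- The factor 1 + b^0 = 2 matches the two occurrences of this series, from m = 0 and from the
  -- subtraction at m = 1.
  have key0 : ser L Set.univ * ∏ i ∈ Finset.Ico 0 (N + 1), (1 + 1 * b ^ i) =
      C * (2 * ser L (ascOn cs {s | (s : ℕ) < N + 1})) := by
    rw [hC, ← hasc (N + 1) le_rfl, Finset.prod_eq_prod_Ico_succ_bot (by omega)]
    simp only [one_mul, pow_zero, zero_add]
    ring
  have hsum := congrArg (ser L Set.univ * ·) hqid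
  simp only [mul_add, Finset.mul_sum] at hsum
  rw [Finset.sum_congr rfl key, ← Finset.mul_sum] at hsum
  simp only [zero_add, pow_one, pow_zero, one_mul, mul_one, qBinom_zero_right, Nat.sub_self,
    Nat.add_sub_cancel, zero_mul, tsub_zero, Finset.Ico_self, Finset.prod_empty] at hsum key1 key0 htel
  rw [Nat.add_sub_cancel, ← hsum]
  linear_combination C * htel - key1 + key0

end AffineSeries

/-! ### Diagram automorphisms -/

section DiagramAutomorphism

variable {B W : Type*} [Group W] {M : CoxeterMatrix B} (cs : CoxeterSystem M W)

/-- A homomorphism permuting the simple reflections does not increase the length. -/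
theorem length_map_le {f : W →* W} {σ : B → B} (hf : ∀ i, f (cs.simple i) = cs.simple (σ i))
    (w : W) : cs.length (f w) ≤ cs.length w := by
  obtain ⟨ω, hω, rfl⟩ := cs.exists_isReduced w
  have : f (cs.wordProd ω) = cs.wordProd (ω.map σ) := by
    simp [CoxeterSystem.wordProd, map_list_prod, Function.comp_def, hf]
  rw [this, hω.eq]
  simpa using cs.length_wordProd_le (ω.map σ)

/-- An involutive symmetry of the Coxeter matrix induces a length preserving endomorphism. -/
theorem exists_diagram_automorphism {σ : B → B} (hσ : ∀ i, σ (σ i) = i)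
    (hM : ∀ i j, M (σ i) (σ j) = M i j) :
    ∃ f : W →* W, (∀ i, f (cs.simple i) = cs.simple (σ i)) ∧
      ∀ w, cs.length (f w) = cs.length w := by
  have hlift : M.IsLiftable fun i => cs.simple (σ i) := fun i j => by
    rw [← hM]; exact cs.simple_mul_simple_pow _ _
  refine ⟨cs.lift ⟨_, hlift⟩, fun i => cs.lift_apply_simple hlift i, fun w => ?_⟩
  set f := cs.lift ⟨_, hlift⟩ with hf
  have hfs : ∀ i, f (cs.simple i) = cs.simple (σ i) := fun i => cs.lift_apply_simple hlift i
  have hff : f.comp f = MonoidHom.id W := cs.ext_simple fun i => by simp [hfs, hσ]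
  have h1 := length_map_le cs hfs w
  have h2 := length_map_le cs hfs (f w)
  have h3 : f (f w) = w := DFunLike.congr_fun hff w
  rw [h3] at h2
  omega

end DiagramAutomorphism

/-! ### The general folding argument -/

section FoldMap

variable {B ι : Type*} [Fintype ι]

/-- The linear map from the root lattice of type `N` taking the simple roots to the `b i`. -/
def foldMap (b : ι → B → ℤ) : (ι → ℤ) →ₗ[ℤ] (B → ℤ) := Fintype.linearCombination ℤ b

theorem foldMap_apply (b : ι → B → ℤ) (x : ι → ℤ) : foldMap b x = ∑ i, x i • b i := rfl

theorem foldMap_single [DecidableEq ι] (b : ι → B → ℤ) (i : ι) :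
    foldMap b (Pi.single i 1) = b i := by
  simp [foldMap_apply, Pi.single_apply]

end FoldMap

section Fold

variable {B ι W : Type*} [Group W] {M : CoxeterMatrix B}

/-- The data by which the Coxeter group of type `N` is realized by folding: `f` is a length
preserving endomorphism fixing the `r i` which is transitive on blocks, and the vectors `b i` are
positive combinations of the simple roots of the blocks which the `r i` transform like simple roots
of type `N`. -/
structure FoldData [Fintype B] [DecidableEq B] {A : B → B → ℤ} (hA : IsCartan M A)
    (cs : CoxeterSystem M W) (A' : ι → ι → ℤ) (p : B → ι) (r : ι → W) (f : W →* W)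
    (b : ι → B → ℤ) : Prop where
  surjective : Function.Surjective p
  mem : ∀ i, r i ∈ parabolic cs (p ⁻¹' {i})
  desc : ∀ i, r i ∈ descOn cs (p ⁻¹' {i})
  length_map : ∀ w, cs.length (f w) = cs.length w
  map_r : ∀ i, f (r i) = r i
  map_simple : ∀ s t, p s = p t → s = t ∨ f (cs.simple s) = cs.simple t
  nonneg : ∀ i, 0 ≤ b i
  ne_zero : ∀ i, b i ≠ 0
  supp : ∀ i s, p s ≠ i → b i s = 0
  rep_r : ∀ i j, hA.rep cs (r i) (b j) = b j - A' i j • b i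

variable [Fintype B] [DecidableEq B] {A : B → B → ℤ} {hA : IsCartan M A}
  {cs : CoxeterSystem M W} {A' : ι → ι → ℤ} {p : B → ι} {r : ι → W} {f : W →* W} {b : ι → B → ℤ}

theorem FoldData.map_mem (h : FoldData hA cs A' p r f b) {w : W} (hw : w ∈ foldingSubgroup r) :
    f w = w := by
  induction hw using Subgroup.closure_induction with
  | mem x hx => obtain ⟨i, rfl⟩ := hx; exact h.map_r i
  | one => simp
  | mul x y _ _ hx hy => rw [map_mul, hx, hy]
  | inv x _ hx => rw [map_inv, hx]

/-- For s ≠ t in one block, f fixes w and sends w s to w t, so these have equal length. -/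
theorem FoldData.ascOn_or_descOn (h : FoldData hA cs A' p r f b) {w : W}
    (hw : w ∈ foldingSubgroup r) (i : ι) :
    w ∈ ascOn cs (p ⁻¹' {i}) ∨ w ∈ descOn cs (p ⁻¹' {i}) := by
  obtain ⟨s, rfl⟩ := h.surjective i
  have key : ∀ t, p t = p s → cs.length (w * cs.simple t) = cs.length (w * cs.simple s) := by
    intro t ht
    rcases h.map_simple s t ht.symm with rfl | hst
    · rfl
    · rw [← h.length_map (w * cs.simple s), map_mul, h.map_mem hw, hst]
  rcases cs.length_mul_simple w s with hs | hs
  · exact Or.inl fun t ht => (key t ht).trans hs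
  · exact Or.inr fun t ht => by rw [key t ht, hs]

theorem FoldData.isAdmissible (h : FoldData hA cs A' p r f b) : IsAdmissible cs p r where
  surjective := h.surjective
  finite_parabolic i := hA.finite_parabolic cs (h.desc i) (h.mem i)
  longest i := hA.isLongestElement cs (h.desc i) (h.mem i)
  ascents_or_descents _ hw i := h.ascOn_or_descOn hw i

/-- Otherwise w descends along the block, so w b_i is both nonnegative and nonpositive, hence zero,
contradicting b_i ≠ 0. -/
theorem FoldData.ascOn_of_nonneg (h : FoldData hA cs A' p r f b) {w : W}
    (hw : w ∈ foldingSubgroup r) {i : ι} (hi : 0 ≤ hA.rep cs w (b i)) :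
    w ∈ ascOn cs (p ⁻¹' {i}) := by
  refine (h.ascOn_or_descOn hw i).resolve_right fun hd => ?_
  have h1 := hA.rep_nonpos_of_descOn cs hd (h.nonneg i) fun s hs => h.supp i s hs
  have h2 := hA.rep_inv_apply_rep cs w (b i)
  rw [le_antisymm h1 hi, map_zero] at h2
  exact h.ne_zero i h2.symm

theorem FoldData.eq_one (h : FoldData hA cs A' p r f b) {w : W} (hw : w ∈ foldingSubgroup r)
    (hfix : ∀ i, hA.rep cs w (b i) = b i) : w = 1 := by
  by_contra hne
  obtain ⟨s, hs⟩ := cs.exists_rightDescent_of_ne_one hne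
  rw [cs.isRightDescent_iff] at hs
  have := h.ascOn_of_nonneg hw (i := p s) (by rw [hfix]; exact h.nonneg _) s rfl
  omega

theorem FoldData.length_pos (h : FoldData hA cs A' p r f b) (i : ι) : 0 < cs.length (r i) := by
  obtain ⟨s, rfl⟩ := h.surjective i
  have := h.desc (p s) s rfl
  omega

variable [Fintype ι] [DecidableEq ι]

theorem FoldData.rep_r_foldMap (h : FoldData hA cs A' p r f b) (i : ι) (x : ι → ℤ) :
    hA.rep cs (r i) (foldMap b x) = foldMap b (rootReflection A' i x) := by
  rw [rootReflection_apply, map_sub, map_smul, foldMap_single, foldMap_apply, map_sum,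
    pairing_apply, Finset.sum_smul, ← Finset.sum_sub_distrib]
  refine Finset.sum_congr rfl fun j _ => ?_
  rw [map_smul, h.rep_r]
  module

variable {N : CoxeterMatrix ι}

/-- By `FoldData.eq_one` a relation among the r_i need only be checked on the vectors b_i, where it
is the relation between reflections of type N. Linear independence of the b_i is not needed. -/
theorem FoldData.isLiftable (h : FoldData hA cs A' p r f b) (hA' : IsCartan N A') :
    N.IsLiftable r := by
  intro i j
  have hr : ∀ k, r k ∈ foldingSubgroup r := fun k =>
    Subgroup.subset_closure (Set.mem_range_self k)
  refine h.eq_one (pow_mem (mul_mem (hr i) (hr j)) _) fun k => ?_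
  have key : ∀ (n : ℕ) (x : ι → ℤ), hA.rep cs ((r i * r j) ^ n) (foldMap b x) =
      foldMap b (((rootReflection A' i * rootReflection A' j) ^ n) x) := by
    intro n
    induction n with
    | zero => simp
    | succ n ih =>
      intro x
      rw [pow_succ, hA.rep_mul_apply, hA.rep_mul_apply, h.rep_r_foldMap, h.rep_r_foldMap, ih,
        pow_succ, Module.End.mul_apply, Module.End.mul_apply]
  rw [← foldMap_single b k, key, hA'.isLiftable i j, Module.End.one_apply]

/-- The homomorphism from the Coxeter group of type `N` onto the folding subgroup. -/
noncomputable def FoldData.hom (h : FoldData hA cs A' p r f b) (hA' : IsCartan N A') :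
    N.Group →* W :=
  N.toCoxeterSystem.lift ⟨r, h.isLiftable hA'⟩

theorem FoldData.hom_simple (h : FoldData hA cs A' p r f b) (hA' : IsCartan N A') (i : ι) :
    h.hom hA' (N.toCoxeterSystem.simple i) = r i :=
  N.toCoxeterSystem.lift_apply_simple _ _

theorem FoldData.range_hom (h : FoldData hA cs A' p r f b) (hA' : IsCartan N A') :
    (h.hom hA').range = foldingSubgroup r := by
  rw [MonoidHom.range_eq_map, ← N.toCoxeterSystem.subgroup_closure_range_simple,
    MonoidHom.map_closure, foldingSubgroup, ← Set.range_comp]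
  congr 2
  funext i
  exact h.hom_simple hA' i

theorem FoldData.rep_hom (h : FoldData hA cs A' p r f b) (hA' : IsCartan N A') (v : N.Group)
    (x : ι → ℤ) : hA.rep cs (h.hom hA' v) (foldMap b x) =
      foldMap b (hA'.rep N.toCoxeterSystem v x) := by
  induction v using N.toCoxeterSystem.simple_induction_left generalizing x with
  | one => simp
  | mul_simple_left v i ih =>
    rw [map_mul, h.hom_simple, hA.rep_mul_apply, ih, h.rep_r_foldMap, hA'.rep_mul_apply,
      hA'.rep_simple]

theorem FoldData.hom_mem (h : FoldData hA cs A' p r f b) (hA' : IsCartan N A') (v : N.Group) :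
    h.hom hA' v ∈ foldingSubgroup r := by
  rw [← h.range_hom hA']
  exact ⟨v, rfl⟩

/-- An ascent of v at i makes v α_i nonnegative, so the image of v sends b_i to a nonnegative vector
and ascends along the whole block. Multiplying by r_i, which lies in the parabolic subgroup of that
block, then adds lengths. -/
theorem FoldData.isWeight (h : FoldData hA cs A' p r f b) (hA' : IsCartan N A') :
    IsWeight N.toCoxeterSystem (fun i => cs.length (r i)) fun v => cs.length (h.hom hA' v) where
  one := by simp
  inv v := by simp
  mul_simple v i hv := by
    rw [map_mul, h.hom_simple]
    refine hA.weight_mul_of_ascOn cs (isWeight_length cs) ?_ (h.mem i)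
    refine h.ascOn_of_nonneg (h.hom_mem hA' v) ?_
    rw [← foldMap_single b i, h.rep_hom, foldMap_apply]
    exact Finset.sum_nonneg fun j _ => smul_nonneg ((hA'.ascent_iff _).1 hv j) (h.nonneg j)

theorem FoldData.hom_injective (h : FoldData hA cs A' p r f b) (hA' : IsCartan N A') :
    Function.Injective (h.hom hA') := by
  rw [injective_iff_map_eq_one]
  intro v hv
  have := (h.isWeight hA').length_le h.length_pos v
  rw [hv, cs.length_one] at this
  exact (N.toCoxeterSystem.length_eq_zero_iff).1 (by omega)

theorem FoldData.isCoxeterOfType (h : FoldData hA cs A' p r f b) (hA' : IsCartan N A') :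
    IsCoxeterOfType N r := by
  let e : N.Group ≃* foldingSubgroup r :=
    (MonoidHom.ofInjective (h.hom_injective hA')).trans (MulEquiv.subgroupCongr (h.range_hom hA'))
  refine ⟨N.toCoxeterSystem.map e, fun i => ?_⟩
  rw [CoxeterSystem.map_simple]
  exact h.hom_simple hA' i

theorem FoldData.unfoldingSeries_eq (h : FoldData hA cs A' p r f b) (hA' : IsCartan N A') :
    unfoldingSeries cs (foldingSubgroup r) =
      ser (fun v => cs.length (h.hom hA' v)) Set.univ := by
  ext k
  rw [unfoldingSeries, coeff_mk, coeff_ser, ← Set.ncard_image_of_injective _ (h.hom_injective hA')]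
  congr 2
  ext w
  rw [← h.range_hom hA']
  constructor
  · rintro ⟨⟨v, rfl⟩, hk⟩
    exact ⟨v, ⟨trivial, hk⟩, rfl⟩
  · rintro ⟨v, ⟨-, hk⟩, rfl⟩
    exact ⟨⟨v, rfl⟩, hk⟩

end Fold

/-! ### Blocks of types A_1, A_1 × A_1 and A_2 -/

section Blocks

theorem simple_mem_descOn {B W : Type*} [Group W] {M : CoxeterMatrix B}
    (cs : CoxeterSystem M W) (s : B) : cs.simple s ∈ descOn cs {s} := by
  rintro _ rfl
  simp

variable {B W : Type*} [Fintype B] [DecidableEq B] [Group W] {M : CoxeterMatrix B}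
  {A : B → B → ℤ} (hA : IsCartan M A) (cs : CoxeterSystem M W)

theorem IsCartan.rep_simple_apply (s : B) (v : B → ℤ) :
    hA.rep cs (cs.simple s) v = v - pairing A s v • Pi.single s 1 := by
  rw [hA.rep_simple, rootReflection_apply]

theorem IsCartan.rep_comm_apply {s t : B} (h : A s t = 0) (v : B → ℤ) :
    hA.rep cs (cs.simple s * cs.simple t) v =
      v - pairing A s v • Pi.single s 1 - pairing A t v • Pi.single t 1 := by
  rw [hA.rep_mul_apply, hA.rep_simple_apply, hA.rep_simple_apply, map_sub, map_smul,
    pairing_single, h]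
  module

/-- The longest element of A_2 is the reflection in the highest root α_s + α_t. -/
theorem IsCartan.rep_braid_apply {s t : B} (h : A s t = -1) (h' : A t s = -1) (v : B → ℤ) :
    hA.rep cs (cs.simple s * cs.simple t * cs.simple s) v =
      v - (pairing A s v + pairing A t v) • (Pi.single s 1 + Pi.single t 1) := by
  simp only [hA.rep_mul_apply, hA.rep_simple_apply, map_sub, map_smul, pairing_single, h, h',
    hA.diag]
  module

theorem IsCartan.length_simple_mul_simple (hA : IsCartan M A) {s t : B} (h : A s t = 0) :
    cs.length (cs.simple s * cs.simple t) = 2 := by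
  rw [(hA.ascent_iff cs).2, cs.length_simple]
  rw [hA.rep_simple_apply, pairing_single, h]
  simp

theorem IsCartan.comm_mem_descOn (hA : IsCartan M A) {s t : B} (h : A s t = 0) (h' : A t s = 0) :
    cs.simple s * cs.simple t ∈ descOn cs {s, t} := by
  rintro u hu
  rw [hA.descent_iff cs, hA.rep_comm_apply cs h]
  rcases hu with rfl | rfl
  · simp only [pairing_single, hA.diag, h']
    intro x
    simp only [Pi.sub_apply, Pi.smul_apply, Pi.single_apply, Pi.zero_apply]
    split_ifs <;> simp
  · simp only [pairing_single, hA.diag, h]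
    intro x
    simp only [Pi.sub_apply, Pi.smul_apply, Pi.single_apply, Pi.zero_apply]
    split_ifs <;> simp

theorem IsCartan.length_braid (hA : IsCartan M A) {s t : B} (h : A s t = -1)
    (h' : A t s = -1) :
    cs.length (cs.simple s * cs.simple t * cs.simple s) = 3 := by
  have key : ∀ u : B, (0 : B → ℤ) ≤ Pi.single u 1 := fun u => Pi.single_nonneg.2 zero_le_one
  rw [(hA.ascent_iff cs).2, (hA.ascent_iff cs).2, cs.length_simple]
  · rw [hA.rep_simple_apply, pairing_single, h]
    refine (add_nonneg (key t) (key s)).trans_eq ?_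
    module
  · simp only [hA.rep_mul_apply, hA.rep_simple_apply, map_sub, map_smul, pairing_single, h, h',
      hA.diag]
    refine (key t).trans_eq ?_
    module

theorem IsCartan.braid_mem_descOn (hA : IsCartan M A) {s t : B} (h : A s t = -1)
    (h' : A t s = -1) :
    cs.simple s * cs.simple t * cs.simple s ∈ descOn cs {s, t} := by
  have key : ∀ u : B, (0 : B → ℤ) ≤ Pi.single u 1 := fun u => Pi.single_nonneg.2 zero_le_one
  rintro u hu
  rw [hA.descent_iff cs, hA.rep_braid_apply cs h h', ← neg_nonneg]
  rcases hu with rfl | rfl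
  · simp only [pairing_single, hA.diag, h']
    refine (key t).trans_eq ?_
    module
  · simp only [pairing_single, hA.diag, h]
    refine (key s).trans_eq ?_
    module

end Blocks

/-! ### The three foldings of type D̃ -/

/-- The Cartan matrix of type `D̃_m`. -/
def cartanAffineD (m : ℕ) (i j : Fin (m + 1)) : ℤ :=
  if i = j then 2 else if EdgeD m i j ∨ EdgeD m j i then -1 else 0

theorem affineD_apply (m : ℕ) (i j : Fin (m + 1)) : affineD m i j =
    if i = j then 1 else if EdgeD m i j ∨ EdgeD m j i then 3 else 2 := rfl

theorem isCartan_affineD (m : ℕ) : IsCartan (affineD m) (cartanAffineD m) where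
  diag i := by simp [cartanAffineD]
  off_diag i j hij := by
    rw [affineD_apply]
    simp only [cartanAffineD, hij, hij.symm, if_false]
    by_cases hE : EdgeD m i j ∨ EdgeD m j i
    · simp only [if_pos hE, if_pos hE.symm]
      simp
    · simp only [if_neg hE, if_neg (show ¬(EdgeD m j i ∨ EdgeD m i j) from fun h => hE h.symm)]
      simp

section FoldFork

variable {n : ℕ}

/-- The vectors realizing the simple roots of `B̃_n` in type `D̃_{n+1}`. -/
def vec₁ (n : ℕ) (i : Fin (n + 1)) : Fin (n + 1 + 1) → ℤ :=
  if (i : ℕ) = 0 then Pi.single ⟨0, by omega⟩ 1 + Pi.single ⟨1, by omega⟩ 1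
  else Pi.single ⟨(i : ℕ) + 1, by omega⟩ 1

/-- The exchange of the generators `0` and `1` of `D̃_{n+1}`. -/
def swap₁ (n : ℕ) (i : Fin (n + 1 + 1)) : Fin (n + 1 + 1) :=
  if (i : ℕ) = 0 then ⟨1, by omega⟩ else if (i : ℕ) = 1 then ⟨0, by omega⟩ else i

theorem val_swap₁ (n : ℕ) (i : Fin (n + 1 + 1)) :
    ((i : ℕ) = 0 ∧ (swap₁ n i : ℕ) = 1) ∨ ((i : ℕ) = 1 ∧ (swap₁ n i : ℕ) = 0) ∨
      (2 ≤ (i : ℕ) ∧ (swap₁ n i : ℕ) = i) := by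
  rw [swap₁]
  split_ifs with h h' <;> simp [h] <;> omega

theorem affineD_swap₁ (hn : 3 ≤ n) (i j : Fin (n + 1 + 1)) :
    affineD (n + 1) (swap₁ n i) (swap₁ n j) = affineD (n + 1) i j := by
  have hi := val_swap₁ n i
  have hj := val_swap₁ n j
  simp only [affineD_apply, EdgeD, Fin.ext_iff]
  generalize (i : ℕ) = x at *
  generalize (j : ℕ) = y at *
  generalize (swap₁ n i : ℕ) = x' at *
  generalize (swap₁ n j : ℕ) = y' at *
  split_ifs <;> grind (splits := 30)

theorem pairing_vec₁ (hn : 3 ≤ n) (s : Fin (n + 1 + 1)) (j : Fin (n + 1)) :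
    pairing (cartanAffineD (n + 1)) s (vec₁ n j) = cartanAffineB n (part₁ n s) j := by
  obtain ⟨i, hi⟩ := s
  obtain ⟨j, hj⟩ := j
  rw [vec₁]
  split_ifs with h
  · rw [map_add, pairing_single, pairing_single]
    simp only [cartanAffineD, cartanAffineB, EdgeD, EdgeB, Fin.ext_iff, part₁] at *
    split_ifs <;> grind (splits := 30)
  · rw [pairing_single]
    simp only [cartanAffineD, cartanAffineB, EdgeD, EdgeB, Fin.ext_iff, part₁] at *
    split_ifs <;> grind (splits := 30)

end FoldFork

section FoldAtVertex

variable {n : ℕ}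

theorem affineD_rev {m : ℕ} (hm : 4 ≤ m) (i j : Fin (m + 1)) :
    affineD m i.rev j.rev = affineD m i j := by
  simp only [affineD_apply, EdgeD, Fin.ext_iff, Fin.val_rev]
  obtain ⟨i, hi⟩ := i
  obtain ⟨j, hj⟩ := j
  simp only
  split_ifs <;> grind (splits := 30)

/-- The vectors realizing the simple roots of `B̃_n` in type `D̃_{2n}`. -/
def vec₂ (n : ℕ) (i : Fin (n + 1)) : Fin (2 * n + 1) → ℤ :=
  Pi.single ⟨n - (i : ℕ), by omega⟩ 1 + Pi.single ⟨n + (i : ℕ), by omega⟩ 1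

/-- For j = 0 both summands of `vec₂` coincide, so b_0 = 2 α_n. The factor 2 at the middle vertex is
absorbed there: subtracting 2 A' α_n is subtracting A' b_0. -/
theorem pairing_vec₂ (hn : 3 ≤ n) (s : Fin (2 * n + 1)) (j : Fin (n + 1)) :
    pairing (cartanAffineD (2 * n)) s (vec₂ n j) =
      (if (s : ℕ) = n then 2 else 1) * cartanAffineB n (part₂ n s) j := by
  obtain ⟨i, hi⟩ := s
  obtain ⟨j, hj⟩ := j
  rw [vec₂, map_add, pairing_single, pairing_single]
  simp only [cartanAffineD, cartanAffineB, EdgeD, EdgeB, Fin.ext_iff, part₂] at *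
  rcases lt_trichotomy i n with h | h | h
  · split_ifs <;> grind (splits := 30)
  · split_ifs <;> grind (splits := 30)
  · split_ifs <;> grind (splits := 30)

end FoldAtVertex

section FoldAtEdge

variable {n : ℕ}

/-- The vectors realizing the simple roots of `B̃_n` in type `D̃_{2n+1}`. -/
def vec₃ (n : ℕ) (i : Fin (n + 1)) : Fin (2 * n + 1 + 1) → ℤ :=
  (if (i : ℕ) = 0 then 2 else 1 : ℤ) •
    (Pi.single ⟨n - (i : ℕ), by omega⟩ 1 + Pi.single ⟨n + 1 + (i : ℕ), by omega⟩ 1)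

/-- The middle block is A_2, whose longest element subtracts the sum of two equal pairings times α_n
+ α_{n+1}; this is why b_0 carries the coefficient 2. -/
theorem pairing_vec₃ (hn : 3 ≤ n) (s : Fin (2 * n + 1 + 1)) (j : Fin (n + 1)) :
    pairing (cartanAffineD (2 * n + 1)) s (vec₃ n j) = cartanAffineB n (part₃ n s) j := by
  obtain ⟨i, hi⟩ := s
  obtain ⟨j, hj⟩ := j
  rw [vec₃, map_smul, map_add, pairing_single, pairing_single]
  simp only [cartanAffineD, cartanAffineB, EdgeD, EdgeB, Fin.ext_iff, part₃, smul_eq_mul] at *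
  rcases lt_or_ge n i with h | h
  · split_ifs <;> grind (splits := 30)
  · split_ifs <;> grind (splits := 30)

end FoldAtEdge

section FoldFork

variable {n : ℕ} {W : Type*} [Group W]

theorem exists_foldData₁ (hn : 3 ≤ n) (cs : CoxeterSystem (affineD (n + 1)) W) :
    ∃ f, FoldData (isCartan_affineD (n + 1)) cs (cartanAffineB n) (part₁ n) (refl₁ n cs) f
      (vec₁ n) := by
  have hA := isCartan_affineD (n + 1)
  obtain ⟨f, hf, hlen⟩ := exists_diagram_automorphism cs (σ := swap₁ n)
    (fun i => by
      have h1 := val_swap₁ n i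
      have h2 := val_swap₁ n (swap₁ n i)
      rw [Fin.ext_iff]
      omega)
    (affineD_swap₁ hn)
  have h01 : cartanAffineD (n + 1) ⟨0, by omega⟩ ⟨1, by omega⟩ = 0 := by
    simp [cartanAffineD, EdgeD]; omega
  have h10 : cartanAffineD (n + 1) ⟨1, by omega⟩ ⟨0, by omega⟩ = 0 := by
    simp [cartanAffineD, EdgeD]; omega
  have hM : affineD (n + 1) ⟨1, by omega⟩ ⟨0, by omega⟩ = 2 := by
    simp [affineD_apply, EdgeD]; omega
  have hfix : ∀ i : Fin (n + 1 + 1), 2 ≤ (i : ℕ) → swap₁ n i = i := fun i hi => by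
    have := val_swap₁ n i
    rw [Fin.ext_iff]
    omega
  refine ⟨f, ⟨fun i => ⟨⟨i + 1, by omega⟩, ?_⟩, fun i => ?_, fun i => ?_, hlen, fun i => ?_,
    fun s t hst => ?_, fun i => ?_, fun i => ?_, fun i s hs => ?_, fun i j => ?_⟩⟩
  · simp [part₁]
  · rw [refl₁]
    split_ifs with h
    · exact mul_mem (simple_mem_parabolic cs (by simp [part₁, Fin.ext_iff, h]))
        (simple_mem_parabolic cs (by simp [part₁, Fin.ext_iff, h]))
    · exact simple_mem_parabolic cs (by simp [part₁])
  · rw [refl₁]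
    split_ifs with h
    · intro s hs
      refine hA.comm_mem_descOn cs h01 h10 s ?_
      have : (s : ℕ) - 1 = i := congrArg Fin.val hs
      simp only [Set.mem_insert_iff, Set.mem_singleton_iff, Fin.ext_iff]
      omega
    · intro s hs
      refine simple_mem_descOn cs _ s ?_
      have : (s : ℕ) - 1 = i := congrArg Fin.val hs
      simp only [Set.mem_singleton_iff, Fin.ext_iff]
      omega
  · rw [refl₁]
    split_ifs with h
    · rw [map_mul, hf, hf, ← simple_comm_of_eq_two cs hM]
      simp [swap₁]
    · rw [hf, hfix _ (by simp; omega)]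
  · have : (s : ℕ) - 1 = (t : ℕ) - 1 := congrArg Fin.val hst
    have hs := val_swap₁ n s
    rw [hf]
    by_cases h : s = t
    · exact Or.inl h
    · rw [Fin.ext_iff] at h
      refine Or.inr (congrArg _ (Fin.ext ?_))
      omega
  · rw [vec₁]
    split_ifs
    · exact add_nonneg (Pi.single_nonneg.2 zero_le_one) (Pi.single_nonneg.2 zero_le_one)
    · exact Pi.single_nonneg.2 zero_le_one
  · intro h0
    have := congrFun h0 ⟨i + 1, by omega⟩
    rw [vec₁] at this
    split_ifs at this with h <;> simp [h] at this
  · have : (s : ℕ) - 1 ≠ i := fun h => hs (Fin.ext h)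
    rw [vec₁]
    split_ifs with h
    · simp only [Pi.add_apply, Pi.single_apply, Fin.ext_iff]
      rw [if_neg (by omega), if_neg (by omega)]; rfl
    · simp only [Pi.single_apply, Fin.ext_iff]
      rw [if_neg (by omega)]
  · have hp : ∀ s, part₁ n s = i → pairing (cartanAffineD (n + 1)) s (vec₁ n j) =
        cartanAffineB n i j := fun s hs => by rw [pairing_vec₁ hn, hs]
    by_cases h : (i : ℕ) = 0
    · rw [refl₁, if_pos h, hA.rep_comm_apply cs h01, hp _ (by simp [part₁, Fin.ext_iff, h]),
        hp _ (by simp [part₁, Fin.ext_iff, h])]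
      nth_rw 3 [vec₁]
      rw [if_pos h]
      module
    · rw [refl₁, if_neg h, hA.rep_simple_apply, hp _ (by simp [part₁])]
      nth_rw 3 [vec₁]
      rw [if_neg h]

theorem length_refl₁ (hn : 3 ≤ n) (cs : CoxeterSystem (affineD (n + 1)) W) (i : Fin (n + 1)) :
    cs.length (refl₁ n cs i) = if (i : ℕ) = 0 then 2 else 1 := by
  rw [refl₁]
  split_ifs
  · refine (isCartan_affineD (n + 1)).length_simple_mul_simple cs ?_
    simp [cartanAffineD, EdgeD]; omega
  · exact cs.length_simple _

end FoldFork

section FoldAtVertex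

variable {n : ℕ} {W : Type*} [Group W]

theorem not_edgeD_reflect₂ (hn : 3 ≤ n) (i : ℕ) :
    ¬(EdgeD (2 * n) (n - i) (n + i) ∨ EdgeD (2 * n) (n + i) (n - i)) := by
  simp only [EdgeD]
  omega

theorem cartanAffineD_reflect₂ (hn : 3 ≤ n) {i : ℕ} (hi : i ≤ n) (hi0 : i ≠ 0) :
    cartanAffineD (2 * n) ⟨n - i, by omega⟩ ⟨n + i, by omega⟩ = 0 ∧
    cartanAffineD (2 * n) ⟨n + i, by omega⟩ ⟨n - i, by omega⟩ = 0 ∧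
    affineD (2 * n) ⟨n + i, by omega⟩ ⟨n - i, by omega⟩ = 2 := by
  have h := not_edgeD_reflect₂ hn i
  have hne : n - i ≠ n + i := by omega
  simp only [cartanAffineD, affineD_apply, Fin.mk.injEq, hne, hne.symm, if_false, if_neg h,
    if_neg (mt Or.symm h), and_self]

theorem exists_foldData₂ (hn : 3 ≤ n) (cs : CoxeterSystem (affineD (2 * n)) W) :
    ∃ f, FoldData (isCartan_affineD (2 * n)) cs (cartanAffineB n) (part₂ n) (refl₂ n cs) f
      (vec₂ n) := by
  have hA := isCartan_affineD (2 * n)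
  obtain ⟨f, hf, hlen⟩ := exists_diagram_automorphism cs (σ := Fin.rev) Fin.rev_rev
    (affineD_rev (by omega))
  refine ⟨f, ⟨fun i => ⟨⟨n + i, by omega⟩, ?_⟩, fun i => ?_, fun i => ?_, hlen, fun i => ?_,
    fun s t hst => ?_, fun i => ?_, fun i => ?_, fun i s hs => ?_, fun i j => ?_⟩⟩
  · simp [part₂]
  · rw [refl₂]
    split_ifs with h
    · exact simple_mem_parabolic cs (by simp [part₂, Fin.ext_iff, h])
    · exact mul_mem (simple_mem_parabolic cs (by simp [part₂, Fin.ext_iff]; omega))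
        (simple_mem_parabolic cs (by simp [part₂]))
  · intro s hs
    have : (s : ℕ) - n + (n - s) = i := congrArg Fin.val hs
    rw [refl₂]
    split_ifs with h
    · refine simple_mem_descOn cs _ s ?_
      simp only [Set.mem_singleton_iff, Fin.ext_iff]
      omega
    · obtain ⟨h1, h2, -⟩ := cartanAffineD_reflect₂ hn i.is_le h
      refine hA.comm_mem_descOn cs h1 h2 s ?_
      simp only [Set.mem_insert_iff, Set.mem_singleton_iff, Fin.ext_iff]
      omega
  · rw [refl₂]
    split_ifs with h
    · rw [hf]
      exact congrArg _ (Fin.ext (by simp only [Fin.val_rev]; omega))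
    · obtain ⟨-, -, hM⟩ := cartanAffineD_reflect₂ hn i.is_le h
      rw [map_mul, hf, hf, ← simple_comm_of_eq_two cs hM]
      congr 2 <;> exact Fin.ext (by simp only [Fin.val_rev]; omega)
  · have : (s : ℕ) - n + (n - s) = t - n + (n - t) := congrArg Fin.val hst
    rw [hf]
    by_cases h : s = t
    · exact Or.inl h
    · rw [Fin.ext_iff] at h
      exact Or.inr (congrArg _ (Fin.ext (by simp only [Fin.val_rev]; omega)))
  · exact add_nonneg (Pi.single_nonneg.2 zero_le_one) (Pi.single_nonneg.2 zero_le_one)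
  · intro h0
    have := congrFun h0 ⟨n + i, by omega⟩
    simp only [vec₂, Pi.add_apply, Pi.single_apply, Pi.zero_apply] at this
    split_ifs at this <;> simp at this
  · have : (s : ℕ) - n + (n - s) ≠ i := fun h => hs (Fin.ext h)
    simp only [vec₂, Pi.add_apply, Pi.single_apply, Fin.ext_iff]
    rw [if_neg (by omega), if_neg (by omega)]; rfl
  · by_cases h : (i : ℕ) = 0
    · rw [refl₂, if_pos h, hA.rep_simple_apply, pairing_vec₂ hn, if_pos rfl]
      rw [show part₂ n ⟨n, by omega⟩ = i by simp [part₂, Fin.ext_iff, h]]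
      nth_rw 3 [vec₂]
      simp only [h, Nat.sub_zero, Nat.add_zero]
      module
    · obtain ⟨h1, -, -⟩ := cartanAffineD_reflect₂ hn i.is_le h
      rw [refl₂, if_neg h, hA.rep_comm_apply cs h1, pairing_vec₂ hn, pairing_vec₂ hn,
        if_neg (by simp only; omega), if_neg (by simp only; omega),
        show part₂ n ⟨n - i, by omega⟩ = i by simp [part₂, Fin.ext_iff]; omega,
        show part₂ n ⟨n + i, by omega⟩ = i by simp [part₂]]
      nth_rw 3 [vec₂]
      module

theorem length_refl₂ (hn : 3 ≤ n) (cs : CoxeterSystem (affineD (2 * n)) W) (i : Fin (n + 1)) :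
    cs.length (refl₂ n cs i) = if (i : ℕ) = 0 then 1 else 2 := by
  rw [refl₂]
  split_ifs with h
  · exact cs.length_simple _
  · exact (isCartan_affineD (2 * n)).length_simple_mul_simple cs
      (cartanAffineD_reflect₂ hn i.is_le h).1

end FoldAtVertex

section FoldAtEdge

variable {n : ℕ} {W : Type*} [Group W]

theorem cartanAffineD_middle₃ (hn : 3 ≤ n) :
    cartanAffineD (2 * n + 1) ⟨n, by omega⟩ ⟨n + 1, by omega⟩ = -1 ∧
    cartanAffineD (2 * n + 1) ⟨n + 1, by omega⟩ ⟨n, by omega⟩ = -1 ∧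
    affineD (2 * n + 1) ⟨n + 1, by omega⟩ ⟨n, by omega⟩ = 3 := by
  have h : EdgeD (2 * n + 1) n (n + 1) := Or.inr (Or.inl ⟨by omega, rfl, by omega⟩)
  have hne : n ≠ n + 1 := by omega
  simp only [cartanAffineD, affineD_apply, Fin.mk.injEq, hne, hne.symm, if_false,
    if_pos (Or.inl h), if_pos (Or.inr h), and_self]

theorem not_edgeD_reflect₃ (hn : 3 ≤ n) {i : ℕ} (hi : i ≠ 0) :
    ¬(EdgeD (2 * n + 1) (n - i) (n + 1 + i) ∨ EdgeD (2 * n + 1) (n + 1 + i) (n - i)) := by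
  simp only [EdgeD]
  omega

theorem cartanAffineD_reflect₃ (hn : 3 ≤ n) {i : ℕ} (hi : i ≤ n) (hi0 : i ≠ 0) :
    cartanAffineD (2 * n + 1) ⟨n - i, by omega⟩ ⟨n + 1 + i, by omega⟩ = 0 ∧
    cartanAffineD (2 * n + 1) ⟨n + 1 + i, by omega⟩ ⟨n - i, by omega⟩ = 0 ∧
    affineD (2 * n + 1) ⟨n + 1 + i, by omega⟩ ⟨n - i, by omega⟩ = 2 := by
  have h := not_edgeD_reflect₃ hn hi0
  have hne : n - i ≠ n + 1 + i := by omega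
  simp only [cartanAffineD, affineD_apply, Fin.mk.injEq, hne, hne.symm, if_false, if_neg h,
    if_neg (mt Or.symm h), and_self]

theorem exists_foldData₃ (hn : 3 ≤ n) (cs : CoxeterSystem (affineD (2 * n + 1)) W) :
    ∃ f, FoldData (isCartan_affineD (2 * n + 1)) cs (cartanAffineB n) (part₃ n) (refl₃ n cs) f
      (vec₃ n) := by
  have hA := isCartan_affineD (2 * n + 1)
  obtain ⟨hs1, hs2, hM3⟩ := cartanAffineD_middle₃ hn
  obtain ⟨f, hf, hlen⟩ := exists_diagram_automorphism cs (σ := Fin.rev) Fin.rev_rev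
    (affineD_rev (by omega))
  refine ⟨f, ⟨fun i => ⟨⟨n + 1 + i, by omega⟩, ?_⟩, fun i => ?_, fun i => ?_, hlen, fun i => ?_,
    fun s t hst => ?_, fun i => ?_, fun i => ?_, fun i s hs => ?_, fun i j => ?_⟩⟩
  · simp only [part₃, Fin.ext_iff]; omega
  · rw [refl₃]
    split_ifs with h
    · have h1 : cs.simple ⟨n, by omega⟩ ∈ parabolic cs (part₃ n ⁻¹' {i}) :=
        simple_mem_parabolic cs (by simp [part₃, Fin.ext_iff, h])
      have h2 : cs.simple ⟨n + 1, by omega⟩ ∈ parabolic cs (part₃ n ⁻¹' {i}) :=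
        simple_mem_parabolic cs (by simp [part₃, Fin.ext_iff, h])
      exact mul_mem (mul_mem h1 h2) h1
    · exact mul_mem (simple_mem_parabolic cs (by simp [part₃, Fin.ext_iff]; omega))
        (simple_mem_parabolic cs (by simp [part₃, Fin.ext_iff]; omega))
  · intro s hs
    have : (s : ℕ) - (n + 1) + (n - s) = i := congrArg Fin.val hs
    rw [refl₃]
    split_ifs with h
    · refine hA.braid_mem_descOn cs hs1 hs2 s ?_
      simp only [Set.mem_insert_iff, Set.mem_singleton_iff, Fin.ext_iff]
      omega
    · obtain ⟨h1, h2, -⟩ := cartanAffineD_reflect₃ hn i.is_le h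
      refine hA.comm_mem_descOn cs h1 h2 s ?_
      simp only [Set.mem_insert_iff, Set.mem_singleton_iff, Fin.ext_iff]
      omega
  · rw [refl₃]
    split_ifs with h
    · rw [map_mul, map_mul, hf, hf, ← simple_braid_of_eq_three cs hM3]
      congr 3 <;> exact Fin.ext (by simp only [Fin.val_rev]; omega)
    · obtain ⟨-, -, hM⟩ := cartanAffineD_reflect₃ hn i.is_le h
      rw [map_mul, hf, hf, ← simple_comm_of_eq_two cs hM]
      congr 2 <;> exact Fin.ext (by simp only [Fin.val_rev]; omega)
  · have : (s : ℕ) - (n + 1) + (n - s) = t - (n + 1) + (n - t) := congrArg Fin.val hst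
    rw [hf]
    by_cases h : s = t
    · exact Or.inl h
    · rw [Fin.ext_iff] at h
      exact Or.inr (congrArg _ (Fin.ext (by simp only [Fin.val_rev]; omega)))
  · exact smul_nonneg (by split_ifs <;> norm_num)
      (add_nonneg (Pi.single_nonneg.2 zero_le_one) (Pi.single_nonneg.2 zero_le_one))
  · intro h0
    have := congrFun h0 ⟨n + 1 + i, by omega⟩
    simp only [vec₃, Pi.smul_apply, Pi.add_apply, Pi.single_apply, Pi.zero_apply] at this
    split_ifs at this <;> simp at this
  · have : (s : ℕ) - (n + 1) + (n - s) ≠ i := fun h => hs (Fin.ext h)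
    simp only [vec₃, Pi.smul_apply, Pi.add_apply, Pi.single_apply, Fin.ext_iff]
    rw [if_neg (show ¬(s : ℕ) = n - i by omega), if_neg (show ¬(s : ℕ) = n + 1 + i by omega)]
    simp
  · have hp : ∀ s, part₃ n s = i → pairing (cartanAffineD (2 * n + 1)) s (vec₃ n j) =
        cartanAffineB n i j := fun s hs => by rw [pairing_vec₃ hn, hs]
    by_cases h : (i : ℕ) = 0
    · rw [refl₃, if_pos h, hA.rep_braid_apply cs hs1 hs2, hp _ (by simp [part₃, Fin.ext_iff, h]),
        hp _ (by simp [part₃, Fin.ext_iff, h])]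
      nth_rw 3 [vec₃]
      simp only [h, if_true, Nat.sub_zero, Nat.add_zero]
      module
    · obtain ⟨h1, -, -⟩ := cartanAffineD_reflect₃ hn i.is_le h
      rw [refl₃, if_neg h, hA.rep_comm_apply cs h1,
        hp _ (by simp [part₃, Fin.ext_iff]; omega), hp _ (by simp [part₃, Fin.ext_iff]; omega)]
      nth_rw 3 [vec₃]
      rw [if_neg h]
      module

theorem length_refl₃ (hn : 3 ≤ n) (cs : CoxeterSystem (affineD (2 * n + 1)) W) (i : Fin (n + 1)) :
    cs.length (refl₃ n cs i) = if (i : ℕ) = 0 then 3 else 2 := by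
  rw [refl₃]
  split_ifs with h
  · obtain ⟨h1, h2, -⟩ := cartanAffineD_middle₃ hn
    exact (isCartan_affineD (2 * n + 1)).length_braid cs h1 h2
  · exact (isCartan_affineD (2 * n + 1)).length_simple_mul_simple cs
      (cartanAffineD_reflect₃ hn i.is_le h).1

end FoldAtEdge

/-! ### Identities for q-integers and the closed forms -/

section Identities

variable {R : Type*} [CommRing R]

theorem qInt_two_mul (m : ℕ) (x : R) : qInt (2 * m) x = (1 + x) * qInt m (x ^ 2) := by
  induction m with
  | zero => simp [qInt]
  | succ m ih =>
    rw [qInt] at *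
    rw [show 2 * (m + 1) = 2 * m + 1 + 1 by ring, Finset.sum_range_succ, Finset.sum_range_succ, ih,
      qInt, qInt, Finset.sum_range_succ]
    ring

theorem qInt_odd_neg_mul (m : ℕ) (x : R) :
    qInt (2 * m + 1) (-x) * (1 + x) = 1 + x ^ (2 * m + 1) := by
  have h := geom_sum_mul (-x) (2 * m + 1)
  rw [Odd.neg_pow ⟨m, rfl⟩] at h
  rw [qInt]
  linear_combination -h

theorem qInt_sub_pow (k : ℕ) (x : R) :
    qInt (2 * k + 1) x - x ^ k = (1 + x ^ (k + 1)) * qInt k x := by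
  have h : qInt (k + 1 + k) x = qInt (k + 1) x + x ^ (k + 1) * qInt k x := by
    simp only [qInt, Finset.sum_range_add, Finset.mul_sum, pow_add]
  have h' : qInt (k + 1) x = qInt k x + x ^ k := by simp only [qInt, Finset.sum_range_succ]
  rw [show 2 * k + 1 = k + 1 + k by ring, h, h']
  ring

/-- The factors are paired as [2i+1]_{-x} [2i+2]_x: the 1 + x split off from the second completes
the first to 1 + x^{2i+1}. -/
theorem prod_qInt_even (n : ℕ) (x : R) :
    ∏ k ∈ Finset.Icc 1 (2 * n), qInt k ((-1) ^ k * x) =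
      ∏ i ∈ Finset.range n, ((1 + x * (x ^ 2) ^ i) * qInt (i + 1) (x ^ 2)) := by
  induction n with
  | zero => simp
  | succ n ih =>
    rw [show 2 * (n + 1) = 2 * n + 1 + 1 by ring, Finset.prod_Icc_succ_top (by omega),
      Finset.prod_Icc_succ_top (by omega), ih, Finset.prod_range_succ,
      Odd.neg_one_pow ⟨n, rfl⟩, Even.neg_one_pow ⟨n + 1, by ring⟩, neg_one_mul, one_mul,
      show 2 * n + 1 + 1 = 2 * (n + 1) by ring, qInt_two_mul]
    linear_combination (∏ i ∈ Finset.range n, ((1 + x * (x ^ 2) ^ i) * qInt (i + 1) (x ^ 2))) *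
      qInt (n + 1) (x ^ 2) * qInt_odd_neg_mul n x

/-- Now the pairs are [2i+2]_x [2i+3]_{-x}, which raises the exponent to 2i + 3 and produces the
weight p = 3. -/
theorem prod_qInt_odd (n : ℕ) (x : R) :
    ∏ k ∈ Finset.Icc 1 (2 * n + 1), qInt k ((-1) ^ k * x) =
      ∏ i ∈ Finset.range n, ((1 + x ^ 3 * (x ^ 2) ^ i) * qInt (i + 1) (x ^ 2)) := by
  induction n with
  | zero => simp [qInt]
  | succ n ih =>
    rw [show 2 * (n + 1) + 1 = 2 * n + 1 + 1 + 1 by ring, Finset.prod_Icc_succ_top (by omega),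
      Finset.prod_Icc_succ_top (by omega), ih, Finset.prod_range_succ,
      Odd.neg_one_pow (n := 2 * n + 1 + 1 + 1) ⟨n + 1, by ring⟩,
      Even.neg_one_pow ⟨n + 1, by ring⟩, neg_one_mul, one_mul,
      show 2 * n + 1 + 1 = 2 * (n + 1) by ring, qInt_two_mul]
    linear_combination (∏ i ∈ Finset.range n, ((1 + x ^ 3 * (x ^ 2) ^ i) * qInt (i + 1) (x ^ 2))) *
      qInt (n + 1) (x ^ 2) * qInt_odd_neg_mul (n + 1) x

/-- A finite form of Euler's theorem on distinct and odd parts; it turns the denominators of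
`ser_affineB` into the odd exponents of the first formula. -/
theorem prod_one_add_pow_mul_prod_odd (n : ℕ) (x : R) :
    (∏ i ∈ Finset.range n, (1 + x ^ (i + 1))) * ∏ i ∈ Finset.range n, (1 - x ^ (2 * i + 1)) =
      ∏ i ∈ Finset.range n, (1 - x ^ (n + 1 + i)) := by
  induction n with
  | zero => simp
  | succ n ih =>
    have h := Finset.prod_range_succ (fun i => 1 - x ^ (n + 1 + i)) n
    rw [Finset.prod_range_succ'] at h
    rw [Finset.prod_range_succ, Finset.prod_range_succ, Finset.prod_range_succ]
    have h' : ∏ i ∈ Finset.range n, (1 - x ^ (n + 1 + (i + 1))) =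
      ∏ i ∈ Finset.range n, (1 - x ^ (n + 1 + 1 + i)) :=
        Finset.prod_congr rfl fun i _ => by ring_nf
    rw [h'] at h
    linear_combination (1 + x ^ (n + 1)) * (1 - x ^ (2 * n + 1)) * ih - (1 + x ^ (n + 1)) * h

theorem prod_Icc_one_eq_range {M : Type*} [CommMonoid M] (n : ℕ) (g : ℕ → M) :
    ∏ k ∈ Finset.Icc 1 n, g k = ∏ i ∈ Finset.range n, g (i + 1) := by
  induction n with
  | zero => simp
  | succ n ih => rw [Finset.prod_Icc_succ_top (by omega), ih, Finset.prod_range_succ]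

theorem prod_Icc_two_eq_Ico {M : Type*} [CommMonoid M] (n : ℕ) (g : ℕ → M) :
    ∏ k ∈ Finset.Icc 2 n, g (k - 1) = ∏ i ∈ Finset.Ico 1 n, g i := by
  have h := Finset.prod_Ico_add' (fun k => g (k - 1)) 1 n 1
  simp only [Nat.add_sub_cancel] at h
  rw [h]
  rfl

theorem prod_Icc_three {M : Type*} [CommMonoid M] {n : ℕ} (hn : 3 ≤ n) (g : ℕ → M) :
    g 1 * g 2 * ∏ k ∈ Finset.Icc 3 n, g k = ∏ i ∈ Finset.range n, g (i + 1) := by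
  rw [← prod_Icc_one_eq_range]
  induction n, hn using Nat.le_induction with
  | base => simp [Finset.prod_Icc_succ_top]
  | succ n hn ih =>
    rw [Finset.prod_Icc_succ_top (by omega), Finset.prod_Icc_succ_top (by omega), ← ih,
      ← mul_assoc]

theorem one_sub_X_pow_mul_inv {k : ℕ} (hk : k ≠ 0) :
    (1 - X ^ k : ℚ⟦X⟧)⁻¹ * (1 - X ^ k) = 1 :=
  PowerSeries.inv_mul_cancel _ (by simp [hk])

end Identities

section Formulas

theorem series_formula₁ {n : ℕ} (hn : 3 ≤ n) {U : ℚ⟦X⟧}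
    (hU : U * ∏ i ∈ Finset.range n, (1 - X ^ 2 * (X ^ 1) ^ (n - 1 + i)) =
      (∏ i ∈ Finset.range n, ((1 + X ^ 2 * (X ^ 1) ^ i) * qInt (i + 1) (X ^ 1))) *
        ∏ i ∈ Finset.Ico 1 n, (1 + (X ^ 1) ^ i)) :
    U = qInt 2 X * qInt 3 (-X) * qInt 4 X * ((1 - X) * (1 - X ^ 3) * (1 + X ^ n))⁻¹ *
      ∏ k ∈ Finset.Icc 3 n, (qInt (2 * k + 1) X - X ^ k) * (1 - X ^ (2 * k - 1))⁻¹ := by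
  have hE : ∏ i ∈ Finset.range n, (1 - X ^ 2 * (X ^ 1) ^ (n - 1 + i) : ℚ⟦X⟧) =
      ∏ i ∈ Finset.range n, (1 - X ^ (n + 1 + i)) :=
    Finset.prod_congr rfl fun i _ => by
      rw [pow_one, ← pow_add, show 2 + (n - 1 + i) = n + 1 + i by omega]
  have hne : ∏ i ∈ Finset.range n, (1 - X ^ (n + 1 + i) : ℚ⟦X⟧) ≠ 0 :=
    Finset.prod_ne_zero_iff.2 fun i _ h => by
      simpa using congrArg (constantCoeff (R := ℚ)) h
  rw [hE] at hU
  have hP : (∏ i ∈ Finset.Ico 1 n, (1 + X ^ i : ℚ⟦X⟧)) * (1 + X ^ n) =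
      ∏ i ∈ Finset.range n, (1 + X ^ (i + 1)) := by
    rw [← prod_Icc_one_eq_range n fun i => (1 + X ^ i : ℚ⟦X⟧), ← Finset.prod_Ico_succ_top (by omega)]
    rfl
  have hO := prod_Icc_three hn fun k => (1 - X ^ (2 * k - 1) : ℚ⟦X⟧)
  have hN := prod_Icc_three hn fun k => (1 + X ^ (k + 1)) * qInt k (X : ℚ⟦X⟧)
  have heuler := prod_one_add_pow_mul_prod_odd n (X : ℚ⟦X⟧)
  have hinv : ((1 - X) * (1 - X ^ 3) * (1 + X ^ n) : ℚ⟦X⟧)⁻¹ *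
      ((1 - X) * (1 - X ^ 3) * (1 + X ^ n)) = 1 :=
    PowerSeries.inv_mul_cancel _ (by simp [show n ≠ 0 by omega])
  have hprod : (∏ k ∈ Finset.Icc 3 n,
      (qInt (2 * k + 1) X - X ^ k) * (1 - X ^ (2 * k - 1) : ℚ⟦X⟧)⁻¹) *
        ∏ k ∈ Finset.Icc 3 n, (1 - X ^ (2 * k - 1) : ℚ⟦X⟧) =
      ∏ k ∈ Finset.Icc 3 n, ((1 + X ^ (k + 1)) * qInt k X) := by
    rw [← Finset.prod_mul_distrib]
    refine Finset.prod_congr rfl fun k hk => ?_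
    have := (Finset.mem_Icc.1 hk).1
    rw [mul_assoc, one_sub_X_pow_mul_inv (by omega), mul_one, qInt_sub_pow]
  -- The prefactor supplies the terms k = 1, 2 of the numerator, whose product in the statement
  -- starts at k = 3.
  have hsmall : (qInt 2 X * qInt 3 (-X) * qInt 4 X : ℚ⟦X⟧) =
      (1 + X ^ (1 + 1)) * qInt 1 X * ((1 + X ^ (2 + 1)) * qInt 2 X) := by
    simp only [qInt, Finset.sum_range_succ, Finset.sum_range_zero]
    ring
  refine mul_right_cancel₀ hne (hU.trans ?_)
  rw [← heuler, ← hP]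
  simp only [pow_one]
  have hN' : ∏ i ∈ Finset.range n, ((1 + X ^ 2 * X ^ i) * qInt (i + 1) (X : ℚ⟦X⟧)) =
      ∏ i ∈ Finset.range n, ((1 + X ^ (i + 1 + 1)) * qInt (i + 1) X) :=
    Finset.prod_congr rfl fun i _ => by ring
  have hO' : ∏ i ∈ Finset.range n, (1 - X ^ (2 * (i + 1) - 1) : ℚ⟦X⟧) =
      ∏ i ∈ Finset.range n, (1 - X ^ (2 * i + 1)) :=
    Finset.prod_congr rfl fun i _ => by rw [show 2 * (i + 1) - 1 = 2 * i + 1 by omega]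
  rw [hN', ← hN, ← hO', ← hO, hsmall, ← hprod]
  simp only [Nat.mul_one, Nat.reduceSub, Nat.reduceMul, pow_one]
  linear_combination (-1) * ((1 + X ^ (1 + 1)) * qInt 1 X * ((1 + X ^ (2 + 1)) * qInt 2 X)) *
    ((∏ k ∈ Finset.Icc 3 n, (qInt (2 * k + 1) X - X ^ k) * (1 - X ^ (2 * k - 1) : ℚ⟦X⟧)⁻¹) *
      ∏ k ∈ Finset.Icc 3 n, (1 - X ^ (2 * k - 1) : ℚ⟦X⟧)) *
    (∏ i ∈ Finset.Ico 1 n, (1 + X ^ i)) * hinv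

theorem series_formula_of_mul {n : ℕ} {U N : ℚ⟦X⟧} {e : ℕ → ℕ} {p : ℕ} (hp : 0 < p)
    (he : ∀ i < n, e (i + 1) = p + 2 * (n - 1 + i))
    (hU : U * ∏ i ∈ Finset.range n, (1 - X ^ p * (X ^ 2) ^ (n - 1 + i)) =
      N * ∏ i ∈ Finset.Ico 1 n, (1 + (X ^ 2) ^ i)) :
    U = N * ((∏ k ∈ Finset.Icc 2 n, (1 + X ^ (2 * (k - 1)))) *
      ∏ k ∈ Finset.Icc 1 n, (1 - X ^ e k)⁻¹) := by
  have hE : ∏ i ∈ Finset.range n, (1 - X ^ p * (X ^ 2) ^ (n - 1 + i) : ℚ⟦X⟧) =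
      ∏ i ∈ Finset.range n, (1 - X ^ e (i + 1)) :=
    Finset.prod_congr rfl fun i hi => by
      rw [← pow_mul, ← pow_add, he i (Finset.mem_range.1 hi)]
  have h0 : ∀ i < n, e (i + 1) ≠ 0 := fun i hi => by rw [he i hi]; omega
  have hne : ∏ i ∈ Finset.range n, (1 - X ^ e (i + 1) : ℚ⟦X⟧) ≠ 0 :=
    Finset.prod_ne_zero_iff.2 fun i hi h => by
      simpa [h0 i (Finset.mem_range.1 hi)] using congrArg (constantCoeff (R := ℚ)) h
  rw [hE] at hU
  refine mul_right_cancel₀ hne (hU.trans ?_)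
  rw [prod_Icc_two_eq_Ico n fun k => (1 + X ^ (2 * k) : ℚ⟦X⟧), prod_Icc_one_eq_range, mul_assoc,
    mul_assoc, ← Finset.prod_mul_distrib, Finset.prod_congr rfl fun i hi =>
      one_sub_X_pow_mul_inv (h0 i (Finset.mem_range.1 hi)), Finset.prod_const_one, mul_one]
  simp only [pow_mul]

end Formulas

/-! ### Assembly of the theorem -/

theorem unfoldingSeries_mul {n : ℕ} (hn : 3 ≤ n) {B W : Type*} [Group W] {M : CoxeterMatrix B}
    [Fintype B] [DecidableEq B] {A : B → B → ℤ} {hA : IsCartan M A} {cs : CoxeterSystem M W}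
    {part : B → Fin (n + 1)} {r : Fin (n + 1) → W} {f : W →* W} {b : Fin (n + 1) → B → ℤ}
    (h : FoldData hA cs (cartanAffineB n) part r f b) {p q : ℕ} (hp : 0 < p) (hq : 0 < q)
    (hlen : ∀ i, cs.length (r i) = if (i : ℕ) = 0 then p else q) :
    unfoldingSeries cs (foldingSubgroup r) *
        ∏ i ∈ Finset.range n, (1 - X ^ p * (X ^ q) ^ (n - 1 + i)) =
      (∏ i ∈ Finset.range n, ((1 + X ^ p * (X ^ q) ^ i) * qInt (i + 1) (X ^ q))) *
        ∏ i ∈ Finset.Ico 1 n, (1 + (X ^ q) ^ i) := by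
  rw [h.unfoldingSeries_eq (isCartan_affineB n)]
  exact ser_affineB hn _ (h.isWeight (isCartan_affineB n)) hp hq hlen

end Folding

theorem theorem1p7 (n : ℕ) (hn : 3 ≤ n)
    {W₁ W₂ W₃ : Type*} [Group W₁] [Group W₂] [Group W₃]
    (cs₁ : CoxeterSystem (affineD (n + 1)) W₁)
    (cs₂ : CoxeterSystem (affineD (2 * n)) W₂)
    (cs₃ : CoxeterSystem (affineD (2 * n + 1)) W₃) :
    (IsAdmissible cs₁ (part₁ n) (refl₁ n cs₁) ∧
      IsCoxeterOfType (affineB n) (refl₁ n cs₁) ∧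
      unfoldingSeries cs₁ (foldingSubgroup (refl₁ n cs₁)) =
        qInt 2 X * qInt 3 (-X) * qInt 4 X * ((1 - X) * (1 - X ^ 3) * (1 + X ^ n))⁻¹ *
          ∏ k ∈ Finset.Icc 3 n, (qInt (2 * k + 1) X - X ^ k) * (1 - X ^ (2 * k - 1))⁻¹) ∧
    (IsAdmissible cs₂ (part₂ n) (refl₂ n cs₂) ∧
      IsCoxeterOfType (affineB n) (refl₂ n cs₂) ∧
      unfoldingSeries cs₂ (foldingSubgroup (refl₂ n cs₂)) =
        (∏ k ∈ Finset.Icc 1 (2 * n), qInt k ((-1) ^ k * X)) *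
          ((∏ k ∈ Finset.Icc 2 n, (1 + X ^ (2 * (k - 1)))) *
            ∏ k ∈ Finset.Icc 1 n, (1 - X ^ (2 * (n + k) - 3))⁻¹)) ∧
    (IsAdmissible cs₃ (part₃ n) (refl₃ n cs₃) ∧
      IsCoxeterOfType (affineB n) (refl₃ n cs₃) ∧
      unfoldingSeries cs₃ (foldingSubgroup (refl₃ n cs₃)) =
        (∏ k ∈ Finset.Icc 1 (2 * n + 1), qInt k ((-1) ^ k * X)) *
          ((∏ k ∈ Finset.Icc 2 n, (1 + X ^ (2 * (k - 1)))) *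
            ∏ k ∈ Finset.Icc 1 n, (1 - X ^ (2 * (n + k) - 1))⁻¹)) := by
  obtain ⟨_, h₁⟩ := exists_foldData₁ hn cs₁
  obtain ⟨_, h₂⟩ := exists_foldData₂ hn cs₂
  obtain ⟨_, h₃⟩ := exists_foldData₃ hn cs₃
  have hB := isCartan_affineB n
  refine ⟨⟨h₁.isAdmissible, h₁.isCoxeterOfType hB, ?_⟩, ⟨h₂.isAdmissible, h₂.isCoxeterOfType hB, ?_⟩,
    ⟨h₃.isAdmissible, h₃.isCoxeterOfType hB, ?_⟩⟩
  · exact series_formula₁ hn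
      (unfoldingSeries_mul hn h₁ two_pos one_pos (length_refl₁ hn cs₁))
  · have h := unfoldingSeries_mul hn h₂ one_pos two_pos (length_refl₂ hn cs₂)
    have hN : ∏ i ∈ Finset.range n, ((1 + X ^ 1 * (X ^ 2) ^ i) * qInt (i + 1) (X ^ 2 : ℚ⟦X⟧)) =
        ∏ k ∈ Finset.Icc 1 (2 * n), qInt k ((-1) ^ k * X) := by
      rw [prod_qInt_even, pow_one]
    rw [hN] at h
    exact series_formula_of_mul (e := fun k => 2 * (n + k) - 3) one_pos (fun i _ => by omega) h
  · have h := unfoldingSeries_mul hn h₃ three_pos two_pos (length_refl₃ hn cs₃)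
    rw [← prod_qInt_odd] at h
    exact series_formula_of_mul (e := fun k => 2 * (n + k) - 1) three_pos (fun i _ => by omega) h
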